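/- **Setting.** Let $\Phi\subset\Lambda$, with coroots in $\Lambda^\vee$, be a reduced simply-laced root datum ($\Lambda$ free of finite rank over $\mathbb Z$, $\Phi$ finite) with simple system $\Delta$. Let $k\subset\mathbb R$ be a subring, $c_1,c_2\in k$ with $c_1^2-4c_2\in k^\times$, $L=k[x]/(x^2-c_1x+c_2)$, $\tau\in L$ the class of $x$, $\sigma=c_1-\tau$. Let $U=L^n$, viewed as a free $k$-module of rank $2n$ with coordinates $(x_i,y_i)_i$ for $(x_i+y_i\tau)_i$, with its dot product $(u\cdot u')=\sum_i (x_ix_i'+y_iy_i')$, and let $T:U\to U$ be multiplication by $\tau$. A *folded representation* of the root datum on $U$ is an injective $k$-linear map $k\otimes_{\mathbb Z}\Lambda\hookrightarrow U$ (regarded as an inclusion) such that * $\alpha^\vee(x)=2(\alpha\cdot x)/(\alpha\cdot\alpha)$ for $\alpha\in\Phi$, $x\in\Lambda$, and $2(\alpha\cdot u)/(\alpha\cdot\alpha)\in k$ for all $u\in U$, so that $s_\alpha(u)=u-\frac{2(\alpha\cdot u)}{(\alpha\cdot\alpha)}\alpha$ is an automorphism of $U$; * $(u\cdot u')$ is the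 coefficient of $1$, in the basis $1,\tau$ of $L$, of $\sum_i u_iu'_i\in L$, for all $u,u'\in U$; * $T(\Lambda)=\Lambda$ and $T(\mathbb Z\Phi)=\mathbb Z\Phi$; * $\Delta=\Delta^T\sqcup\Delta_{rat}\sqcup T(\Delta_{rat})$, where $\Delta^T=\{\alpha\in\Delta: T\alpha=\alpha\}$ and each $\alpha\in\Delta_{rat}$ satisfies $\sum_i\alpha_i^2\in k$. Fix a folded representation. Let $W=\langle s_\alpha:\alpha\in\Phi\rangle\le GL_k(U)$, with simple reflections $S=\{s_\alpha:\alpha\in\Delta\}$. Let $U_\tau\subset L\otimes_kU$ be the $\tau$-eigenspace of the $L$-linear extension of $T$. For $\alpha\in\Delta^T$ (resp. $\alpha\in\Delta_{rat}$) let $R_\alpha$ be the restriction to $U_\tau$ of the $L$-linear extension of $s_\alpha$ (resp. of $s_\alpha s_{T\alpha}$). Let $S_\tau=\{R_\alpha:\alpha\in\Delta^T\sqcup\Delta_{rat}\}$ and $W_\tau=\langle S_\tau\rangle\le GL_L(U_\tau)$. Let $\varepsilon:W_\tau\hookrightarrow W$ be the group embedding with $R_\alpha\mapsto s_\alpha$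 for $\alpha\in\Delta^T$ and $R_\alpha\mapsto s_\alpha s_{T\alpha}$ for $\alpha\in\Delta_{rat}$ (it is induced by the $k$-isomorphism $U\to U_\tau$, $u\mapsto(\tau-\sigma)^{-1}(T-\sigma)u$), and let $\varphi:S\to S_\tau$ be the map $s_\alpha,s_{T\alpha}\mapsto R_\alpha$ for $\alpha\in\Delta^T\sqcup\Delta_{rat}$. Lengths $l$, $l_\tau$, reduced words and Bruhat orders $\le$ on $W$, $W_\tau$ are taken with respect to $S$, $S_\tau$. The *folding subset* $W^\varphi\subset W$ consists of $e$ and of all $w$ such that (FS1) for each reduced word $s_1\cdots s_m$ of $w$ the word $\varphi(s_1)\cdots\varphi(s_m)$ is reduced in $W_\tau$, and (FS2) for any two reduced words of $w$ the two resulting words represent the same element of $W_\tau$. Let $\bar\varphi:W^\varphi\to W_\tau$ be the map $\bar\varphi(w)=\varphi(s_1)\cdots\varphi(s_m)$ for any reduced word $s_1\cdots s_m$ of $w$ (so $\bar\varphi(e)=e$). **Theorem.** Let $u\in W_\tau$ with $l_\tau(u)=\ell$, and let $w\in W$. Then the three conditions * (C1) $l(w)=\ell$, * (C2) $w\le\varepsilon(u)$,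 * (C3) $w\not\le\varepsilon(u')$ for all $u'\in W_\tau$ with $u\not\le u'$ hold together if and only if $w\in W^\varphi$ and $\bar\varphi(w)=u$. -/

import Mathlib

open scoped TensorProduct

/-! ### Words, length and Bruhat order for a group with a family of generators -/

section Coxeter

variable {G : Type*} [Group G] {I : Type*}

/-- The element of `G` represented by a word in the generators `s`. -/
def wordProd (s : I → G) (l : List I) : G := (l.map s).prod

/-- The length of `g` with respect to the generators `s`: the least length of a word in the
generators representing `g` (all generators used below are involutions). -/
noncomputable def genLength (s : I → G) (g : G) : ℕ :=
  sInf {m | ∃ l : List I, l.length = m ∧ wordProd s l = g}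

/-- The set of reduced words representing `g`. -/
def redWords (s : I → G) (g : G) : Set (List I) :=
  {l | wordProd s l = g ∧ l.length = genLength s g}

/-- The set of all reduced words. -/
def allRedWords (s : I → G) : Set (List I) := ⋃ g, redWords s g

/-- The reflections: the conjugates of the generators. -/
def genReflections (s : I → G) : Set G := {t | ∃ (g : G) (i : I), t = g * s i * g⁻¹}

/-- The Bruhat order: the reflexive and transitive closure of `g < g * t`, for `t` a reflection
such that the length of `g * t` is larger than that of `g`. -/
def bruhatLE (s : I → G) : G → G → Prop :=
  Relation.ReflTransGen fun g h =>
    ∃ t ∈ genReflections s, h = g * t ∧ genLength s g < genLength s h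

end Coxeter

namespace Folding

noncomputable section

/-! ### The quadratic algebra `L = k[x]/(x² - c₁ x + c₂)` and the module `U` -/

section Quadratic

variable (k : Subring ℝ) (c₁ c₂ : k) (n : ℕ)

/-- The quadratic `k`-algebra `k[x]/(x² - c₁ x + c₂)`, with its `k`-basis `1, τ`. -/
abbrev L : Type := QuadraticAlgebra k (-c₂) c₁

/-- The root `τ` (the class of `x`) of `x² - c₁ x + c₂` in `L`. -/
abbrev tau : L k c₁ c₂ := ⟨0, 1⟩

/-- The other root `σ = c₁ - τ`. -/
abbrev sigma : L k c₁ c₂ := ⟨c₁, -1⟩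

/-- The free `L`-module `Lⁿ`; seen as a `k`-module it is `U`, free of rank `2 n`, with coordinates
`(u i).re`, `(u i).im`. -/
abbrev U : Type := Fin n → L k c₁ c₂

variable {k c₁ c₂ n}

theorem tau_mul_tau : tau k c₁ c₂ * tau k c₁ c₂ = c₁ • tau k c₁ c₂ - c₂ • 1 := by
  ext <;> simp [QuadraticAlgebra.re_one, QuadraticAlgebra.im_one]

theorem poly_factor (z : L k c₁ c₂) :
    z ^ 2 - c₁ • z + c₂ • 1 = (z - tau k c₁ c₂) * (z - sigma k c₁ c₂) := by
  ext <;> simp [pow_two, QuadraticAlgebra.re_one, QuadraticAlgebra.im_one] <;> ring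

theorem tau_sub_sigma_sq :
    (tau k c₁ c₂ - sigma k c₁ c₂) * (tau k c₁ c₂ - sigma k c₁ c₂)
      = algebraMap k (L k c₁ c₂) (c₁ ^ 2 - 4 * c₂) := by
  have h4 : (4 : k) = 2 + 2 := by norm_num
  ext
  · simp only [QuadraticAlgebra.re_mul, QuadraticAlgebra.re_sub, QuadraticAlgebra.im_sub,
      QuadraticAlgebra.algebraMap_re]
    congr 1
    ring
  · simp only [QuadraticAlgebra.im_mul, QuadraticAlgebra.re_sub, QuadraticAlgebra.im_sub,
      QuadraticAlgebra.algebraMap_im]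
    congr 1
    ring

/-- The dot product of `Lⁿ`, with values in `L`. -/
def dotL (u v : U k c₁ c₂ n) : L k c₁ c₂ := ∑ i, u i * v i

/-- The dot product of the free `k`-module `U` of rank `2 n`. -/
def dotU (u v : U k c₁ c₂ n) : k := ∑ i, ((u i).re * (v i).re + (u i).im * (v i).im)

/-- The `τ`-form: `pr_τ (u · v)`, where `pr_τ (x + y τ) = x`. -/
def tauForm (u v : U k c₁ c₂ n) : k := (dotL u v).re

/-- The `τ`-operator: multiplication by `τ`. -/
def tauOp : U k c₁ c₂ n →ₗ[k] U k c₁ c₂ n where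
  toFun u := tau k c₁ c₂ • u
  map_add' u v := smul_add _ u v
  map_smul' a u := smul_comm _ a u

/-- A vector is `τ`-rational if it is nonzero and its square in `L` lies in `k`. -/
def TauRational (u : U k c₁ c₂ n) : Prop :=
  u ≠ 0 ∧ dotL u u ∈ Set.range (algebraMap k (L k c₁ c₂))

theorem dotU_add_right (u v w : U k c₁ c₂ n) : dotU u (v + w) = dotU u v + dotU u w := by
  simp only [dotU, ← Finset.sum_add_distrib]
  refine Finset.sum_congr rfl fun i _ => ?_
  simp only [Pi.add_apply, QuadraticAlgebra.re_add, QuadraticAlgebra.im_add]; ring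

theorem dotU_smul_right (u v : U k c₁ c₂ n) (a : k) : dotU u (a • v) = a * dotU u v := by
  simp only [dotU, Finset.mul_sum]
  refine Finset.sum_congr rfl fun i _ => ?_
  simp only [Pi.smul_apply, QuadraticAlgebra.re_smul, QuadraticAlgebra.im_smul, smul_eq_mul]; ring

theorem dotU_self_ne_zero {u : U k c₁ c₂ n} (hu : u ≠ 0) : dotU u u ≠ 0 := by
  intro h
  apply hu
  have h' : ∑ i, (((u i).re : ℝ) * (u i).re + ((u i).im : ℝ) * (u i).im) = 0 := by
    have := congrArg (Subtype.val : k → ℝ) h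
    simpa [dotU] using this
  rw [Finset.sum_eq_zero_iff_of_nonneg
    (fun i _ => add_nonneg (mul_self_nonneg _) (mul_self_nonneg _))] at h'
  funext i
  have hi := h' i (Finset.mem_univ i)
  have h1 : ((u i).re : ℝ) = 0 := by
    nlinarith [mul_self_nonneg ((u i).re : ℝ), mul_self_nonneg ((u i).im : ℝ)]
  have h2 : ((u i).im : ℝ) = 0 := by
    nlinarith [mul_self_nonneg ((u i).re : ℝ), mul_self_nonneg ((u i).im : ℝ)]
  ext
  · simpa using h1
  · simpa using h2

theorem tauForm_tauOp (u v : U k c₁ c₂ n) : tauForm u (tauOp v) = tauForm (tauOp u) v := by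
  simp only [tauForm, dotL, tauOp, LinearMap.coe_mk, AddHom.coe_mk, Pi.smul_apply, smul_eq_mul]
  congr 1
  exact Finset.sum_congr rfl fun i _ => by ring

theorem tauOp_tauOp (u : U k c₁ c₂ n) : tauOp (tauOp u) = c₁ • tauOp u - c₂ • u := by
  have : tauOp (tauOp u) = (tau k c₁ c₂ * tau k c₁ c₂) • u := (mul_smul _ _ u).symm
  rw [this, tau_mul_tau, sub_smul, smul_assoc, smul_assoc, one_smul]
  rfl

/-! ### Extension of scalars and the `τ`-eigenspace -/

variable (k c₁ c₂ n) in
/-- The eigenspace `U_τ`, for the eigenvalue `τ`, of the `L`-linear extension of the `τ`-operator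
to `L ⊗ U`. -/
abbrev Utau : Submodule (L k c₁ c₂) (L k c₁ c₂ ⊗[k] U k c₁ c₂ n) :=
  Module.End.eigenspace ((tauOp (n := n)).baseChange (L k c₁ c₂)) (tau k c₁ c₂)

/-- A `k`-linear automorphism of `U` commuting with the `τ`-operator, extended to `L ⊗ U` and then
restricted to `U_τ`. -/
def restrictUtau (g : U k c₁ c₂ n ≃ₗ[k] U k c₁ c₂ n) (hg : ∀ u, g (tauOp u) = tauOp (g u)) :
    Utau k c₁ c₂ n ≃ₗ[L k c₁ c₂] Utau k c₁ c₂ n :=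
  have key : ∀ f : U k c₁ c₂ n →ₗ[k] U k c₁ c₂ n, (∀ u, f (tauOp u) = tauOp (f u)) →
      ∀ x ∈ Utau k c₁ c₂ n, f.baseChange (L k c₁ c₂) x ∈ Utau k c₁ c₂ n := fun f hf x hx => by
    rw [Module.End.mem_eigenspace_iff] at hx ⊢
    rw [← map_smul, ← hx, ← LinearMap.comp_apply, ← LinearMap.comp_apply,
      ← LinearMap.baseChange_comp, ← LinearMap.baseChange_comp]
    congr 2
    exact LinearMap.ext fun u => (hf u).symm
  have hg' : ∀ u, g.symm (tauOp u) = tauOp (g.symm u) := fun u => by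
    rw [LinearEquiv.symm_apply_eq, hg, LinearEquiv.apply_symm_apply]
  LinearEquiv.ofLinearMap
    ((g.toLinearMap.baseChange (L k c₁ c₂)).restrict (key _ hg))
    ((g.symm.toLinearMap.baseChange (L k c₁ c₂)).restrict (key _ hg'))
    (by
      ext x
      simp only [LinearMap.coe_comp, Function.comp_apply, LinearMap.restrict_apply,
        LinearMap.id_coe, id_eq]
      rw [← LinearMap.comp_apply, ← LinearMap.baseChange_comp]
      simp)
    (by
      ext x
      simp only [LinearMap.coe_comp, Function.comp_apply, LinearMap.restrict_apply,
        LinearMap.id_coe, id_eq]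
      rw [← LinearMap.comp_apply, ← LinearMap.baseChange_comp]
      simp)

theorem restrictUtau_coe (g : U k c₁ c₂ n ≃ₗ[k] U k c₁ c₂ n) (hg) (x : Utau k c₁ c₂ n) :
    (restrictUtau g hg x : L k c₁ c₂ ⊗[k] U k c₁ c₂ n)
      = g.toLinearMap.baseChange (L k c₁ c₂) x := rfl

/-- The projection `U → L ⊗ U → U_τ`, `u ↦ (τ - σ)⁻¹ (T - σ) u`, where `T` is the
`τ`-operator (here with values in `L ⊗ U`). -/
def tauProjAux : U k c₁ c₂ n →ₗ[k] L k c₁ c₂ ⊗[k] U k c₁ c₂ n where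
  toFun u := Ring.inverse (tau k c₁ c₂ - sigma k c₁ c₂) •
    (1 ⊗ₜ[k] tauOp u - sigma k c₁ c₂ ⊗ₜ[k] u)
  map_add' u v := by
    rw [← smul_add, map_add, TensorProduct.tmul_add, TensorProduct.tmul_add]
    congr 1; abel
  map_smul' a u := by
    rw [map_smul, TensorProduct.tmul_smul, TensorProduct.tmul_smul, ← smul_sub a (_ : L k c₁ c₂ ⊗[k] U k c₁ c₂ n) _, smul_comm]
    rfl

theorem isUnit_tau_sub_sigma (hD : IsUnit (c₁ ^ 2 - 4 * c₂)) :
    IsUnit (tau k c₁ c₂ - sigma k c₁ c₂) := by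
  have h : IsUnit ((tau k c₁ c₂ - sigma k c₁ c₂) * (tau k c₁ c₂ - sigma k c₁ c₂)) := by
    rw [tau_sub_sigma_sq]; exact hD.map _
  exact isUnit_of_mul_isUnit_left h

theorem sigma_eq : sigma k c₁ c₂ = c₁ • 1 - tau k c₁ c₂ := by
  ext <;> simp [QuadraticAlgebra.re_one, QuadraticAlgebra.im_one]

theorem tauProjAux_eq (u : U k c₁ c₂ n) : tauProjAux u =
    Ring.inverse (tau k c₁ c₂ - sigma k c₁ c₂) •
      (1 ⊗ₜ[k] (tauOp u - c₁ • u) + tau k c₁ c₂ ⊗ₜ[k] u) := by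
  change Ring.inverse (tau k c₁ c₂ - sigma k c₁ c₂) •
    ((1 : L k c₁ c₂) ⊗ₜ[k] tauOp u - sigma k c₁ c₂ ⊗ₜ[k] u) = _
  congr 1
  rw [sigma_eq, TensorProduct.sub_tmul, TensorProduct.tmul_sub, TensorProduct.smul_tmul]
  abel

theorem tauProjAux_mem (u : U k c₁ c₂ n) : tauProjAux u ∈ Utau k c₁ c₂ n := by
  rw [Module.End.mem_eigenspace_iff, tauProjAux_eq, map_smul, smul_comm]
  congr 1
  simp only [map_add, LinearMap.baseChange_tmul, map_sub, tauOp_tauOp, smul_add,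
    TensorProduct.smul_tmul', smul_eq_mul, mul_smul_comm, mul_one, tau_mul_tau, smul_sub,
    TensorProduct.sub_tmul, TensorProduct.tmul_sub, TensorProduct.tmul_smul]
  abel

/-- Coordinates of `L ⊗ U = (1 ⊗ U) ⊕ (τ ⊗ U)`. -/
theorem exists_eq_tmul (x : L k c₁ c₂ ⊗[k] U k c₁ c₂ n) :
    ∃ a b, x = 1 ⊗ₜ[k] a + tau k c₁ c₂ ⊗ₜ[k] b := by
  induction x with
  | zero => exact ⟨0, 0, by simp⟩
  | tmul z u =>
    refine ⟨z.re • u, z.im • u, ?_⟩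
    rw [← TensorProduct.smul_tmul, ← TensorProduct.smul_tmul, ← TensorProduct.add_tmul]
    congr 1
    ext <;> simp [QuadraticAlgebra.re_one, QuadraticAlgebra.im_one]
  | add x y hx hy =>
    obtain ⟨a, b, rfl⟩ := hx
    obtain ⟨a', b', rfl⟩ := hy
    exact ⟨a + a', b + b', by rw [TensorProduct.tmul_add, TensorProduct.tmul_add]; abel⟩

theorem tmul_inj {a b a' b' : U k c₁ c₂ n}
    (h : 1 ⊗ₜ[k] a + tau k c₁ c₂ ⊗ₜ[k] b = 1 ⊗ₜ[k] a' + tau k c₁ c₂ ⊗ₜ[k] b') :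
    a = a' ∧ b = b' := by
  constructor
  · simpa [QuadraticAlgebra.re_one] using congrArg (TensorProduct.lid k (U k c₁ c₂ n)
      ∘ (QuadraticAlgebra.reₗ (-c₂) c₁).rTensor (U k c₁ c₂ n)) h
  · simpa [QuadraticAlgebra.im_one] using congrArg (TensorProduct.lid k (U k c₁ c₂ n)
      ∘ (QuadraticAlgebra.imₗ (-c₂) c₁).rTensor (U k c₁ c₂ n)) h

/-- The projection `U → U_τ`, `u ↦ (τ - σ)⁻¹ (T - σ) u`. -/
def tauProj : U k c₁ c₂ n →ₗ[k] Utau k c₁ c₂ n where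
  toFun u := ⟨tauProjAux u, tauProjAux_mem u⟩
  map_add' u v := Subtype.ext (map_add _ u v)
  map_smul' a u := Subtype.ext (map_smul _ a u)

theorem tauProj_bijective (hD : IsUnit (c₁ ^ 2 - 4 * c₂)) :
    Function.Bijective (tauProj : U k c₁ c₂ n →ₗ[k] Utau k c₁ c₂ n) := by
  have hu := isUnit_tau_sub_sigma hD
  have hsm : ∀ u : U k c₁ c₂ n, (tau k c₁ c₂ - sigma k c₁ c₂) • tauProjAux u =
      1 ⊗ₜ[k] (tauOp u - c₁ • u) + tau k c₁ c₂ ⊗ₜ[k] u := fun u => by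
    rw [tauProjAux_eq, smul_smul, Ring.mul_inverse_cancel _ hu, one_smul]
  constructor
  · intro u v h
    have h' : tauProjAux u = tauProjAux v := congrArg Subtype.val h
    have := congrArg (fun x => (tau k c₁ c₂ - sigma k c₁ c₂) • x) h'
    simp only [hsm] at this
    exact (tmul_inj this).2
  · rintro ⟨x, hx⟩
    obtain ⟨a, b, hab⟩ := exists_eq_tmul ((tau k c₁ c₂ - sigma k c₁ c₂) • x)
    refine ⟨b, Subtype.ext ?_⟩
    change tauProjAux b = x
    have hx' : (tau k c₁ c₂ - sigma k c₁ c₂) • x ∈ Utau k c₁ c₂ n := Submodule.smul_mem _ _ hx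
    rw [Module.End.mem_eigenspace_iff, hab] at hx'
    have e : (1 : L k c₁ c₂) ⊗ₜ[k] tauOp a + tau k c₁ c₂ ⊗ₜ[k] tauOp b =
        1 ⊗ₜ[k] (-(c₂ • b)) + tau k c₁ c₂ ⊗ₜ[k] (a + c₁ • b) := by
      have e1 : tau k c₁ c₂ • ((1 : L k c₁ c₂) ⊗ₜ[k] a + tau k c₁ c₂ ⊗ₜ[k] b) =
          1 ⊗ₜ[k] (-(c₂ • b)) + tau k c₁ c₂ ⊗ₜ[k] (a + c₁ • b) := by
        simp only [smul_add, TensorProduct.smul_tmul', smul_eq_mul, mul_one, tau_mul_tau,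
          TensorProduct.sub_tmul, TensorProduct.smul_tmul, TensorProduct.tmul_add,
          TensorProduct.tmul_neg]
        abel
      rw [← e1, ← hx']
      simp
    have hab' := (tmul_inj e).2
    have ha : a = tauOp b - c₁ • b := by rw [hab']; abel
    rw [ha, ← hsm] at hab
    have := congrArg (fun y => Ring.inverse (tau k c₁ c₂ - sigma k c₁ c₂) • y) hab
    simp only [smul_smul, Ring.inverse_mul_cancel _ hu, one_smul] at this
    exact this.symm

theorem restrictUtau_tauProj (g : U k c₁ c₂ n ≃ₗ[k] U k c₁ c₂ n) (hg) (u : U k c₁ c₂ n) :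
    restrictUtau g hg (tauProj u) = tauProj (g u) := by
  apply Subtype.ext
  rw [restrictUtau_coe]
  change g.toLinearMap.baseChange _ (tauProjAux u) = tauProjAux (g u)
  simp [tauProjAux_eq, hg]

/-- The isomorphism `U ≃ U_τ` given by the projection. -/
def tauProjEquiv (hD : IsUnit (c₁ ^ 2 - 4 * c₂)) : U k c₁ c₂ n ≃ₗ[k] Utau k c₁ c₂ n :=
  LinearEquiv.ofBijective tauProj (tauProj_bijective hD)

/-- Transport of automorphisms of `U_τ` to `U` along the projection. -/
def pullback (hD : IsUnit (c₁ ^ 2 - 4 * c₂)) :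
    (Utau k c₁ c₂ n ≃ₗ[L k c₁ c₂] Utau k c₁ c₂ n) →* (U k c₁ c₂ n ≃ₗ[k] U k c₁ c₂ n) where
  toFun g := (tauProjEquiv hD).trans ((g.restrictScalars k).trans (tauProjEquiv hD).symm)
  map_one' := LinearEquiv.ext fun u => (tauProjEquiv hD).symm_apply_apply u
  map_mul' g h := LinearEquiv.ext fun u => by
    change (tauProjEquiv hD).symm (g (h (tauProjEquiv hD u))) =
      (tauProjEquiv hD).symm (g (tauProjEquiv hD ((tauProjEquiv hD).symm (h (tauProjEquiv hD u)))))
    rw [LinearEquiv.apply_symm_apply]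

end Quadratic

/-! ### Folded representations -/

section Folded

variable {ι X Y : Type*} [AddCommGroup X] [AddCommGroup Y] {P : RootDatum ι X Y}

/-- A folded `k`-representation of the root datum `P` with simple system `b`: a geometric
`k`-representation on `U = Lⁿ` (restriction of scalars), where `L = k[x]/(x² - c₁ x + c₂)` is
separable, compatible with the `τ`-operator. -/
structure FoldedRep (b : P.Base) (k : Subring ℝ) (c₁ c₂ : k) (n : ℕ) where
  /-- `L` is separable over `k`. -/
  isUnit_disc : IsUnit (c₁ ^ 2 - 4 * c₂)
  /-- `U` contains `Λ ⊗ k`. -/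
  incl : k ⊗[ℤ] X →ₗ[k] U k c₁ c₂ n
  incl_injective : Function.Injective incl
  /-- `α^∨(x) = 2 (α · x) / (α · α)` for `x` in the lattice. -/
  coroot_eq : ∀ (i : ι) (x : X), ((P.toLinearMap x (P.coroot i) : ℤ) : ℝ) =
    2 * (dotU (incl (1 ⊗ₜ P.root i)) (incl (1 ⊗ₜ x)) : ℝ) /
      (dotU (incl (1 ⊗ₜ P.root i)) (incl (1 ⊗ₜ P.root i)) : ℝ)
  /-- The same formula defines reflections on all of `U`. -/
  coroot_mem : ∀ (i : ι) (u : U k c₁ c₂ n), 2 * (dotU (incl (1 ⊗ₜ P.root i)) u : ℝ) /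
      (dotU (incl (1 ⊗ₜ P.root i)) (incl (1 ⊗ₜ P.root i)) : ℝ) ∈ k
  /-- The `τ`-form is the dot product. -/
  tauForm_eq : ∀ u v : U k c₁ c₂ n, tauForm u v = dotU u v
  /-- The `τ`-operator preserves the lattice. -/
  tauOp_lattice : tauOp '' Set.range (fun x : X => incl (1 ⊗ₜ x)) =
    Set.range (fun x : X => incl (1 ⊗ₜ x))
  /-- The `τ`-operator preserves the root lattice. -/
  tauOp_rootLattice :
    tauOp '' ((fun x : X => incl (1 ⊗ₜ x)) '' Submodule.span ℤ (Set.range P.root)) =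
      (fun x : X => incl (1 ⊗ₜ x)) '' Submodule.span ℤ (Set.range P.root)
  /-- The set `Δ_rat` of simple roots. -/
  rat : Set b.support
  tauRational : ∀ i ∈ rat, TauRational (incl (1 ⊗ₜ P.root i))
  /-- The images of the elements of `Δ_rat` under the `τ`-operator, which are simple roots. -/
  tauRat : rat → b.support
  incl_tauRat : ∀ i : rat, incl (1 ⊗ₜ P.root (tauRat i)) = tauOp (incl (1 ⊗ₜ P.root (i : b.support)))
  /-- `Δ` is the disjoint union of the set of `τ`-invariant simple roots, `Δ_rat` and its image. -/
  disjoint_inv_rat :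
    Disjoint {i : b.support | tauOp (incl (1 ⊗ₜ P.root i)) = incl (1 ⊗ₜ P.root i)} rat
  disjoint_inv_tauRat :
    Disjoint {i : b.support | tauOp (incl (1 ⊗ₜ P.root i)) = incl (1 ⊗ₜ P.root i)}
      (Set.range tauRat)
  disjoint_rat_tauRat : Disjoint rat (Set.range tauRat)
  partition : {i : b.support | tauOp (incl (1 ⊗ₜ P.root i)) = incl (1 ⊗ₜ P.root i)} ∪ rat ∪
    Set.range tauRat = Set.univ

namespace FoldedRep

variable {b : P.Base} {k : Subring ℝ} {c₁ c₂ : k} {n : ℕ} (F : FoldedRep b k c₁ c₂ n)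

/-- The roots as vectors of `U`. -/
def vec (i : ι) : U k c₁ c₂ n := F.incl (1 ⊗ₜ P.root i)

theorem vec_ne_zero (i : ι) : F.vec i ≠ 0 := by
  intro h
  have h2 := F.coroot_eq i (P.root i)
  rw [P.root_coroot_two] at h2
  change _ = 2 * (dotU (F.vec i) (F.vec i) : ℝ) / (dotU (F.vec i) (F.vec i) : ℝ) at h2
  rw [h] at h2
  simp [dotU] at h2

theorem dot_vec_ne_zero (i : ι) : (dotU (F.vec i) (F.vec i) : ℝ) ≠ 0 := by
  simpa using dotU_self_ne_zero (F.vec_ne_zero i)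

/-- The linear form `u ↦ 2 (α · u) / (α · α)` on `U`. -/
def coform (i : ι) : U k c₁ c₂ n →ₗ[k] k where
  toFun u := ⟨2 * (dotU (F.vec i) u : ℝ) / (dotU (F.vec i) (F.vec i) : ℝ), F.coroot_mem i u⟩
  map_add' u v := Subtype.ext <| by
    simp only [dotU_add_right, Subring.coe_add]; ring
  map_smul' a u := Subtype.ext <| by
    simp only [dotU_smul_right, Subring.coe_mul, RingHom.id_apply, smul_eq_mul]; ring

theorem coform_vec (i : ι) : F.coform i (F.vec i) = 2 :=
  Subtype.ext <| by
    change 2 * (dotU (F.vec i) (F.vec i) : ℝ) / (dotU (F.vec i) (F.vec i) : ℝ) = _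
    rw [mul_div_assoc, div_self (F.dot_vec_ne_zero i), mul_one]; rfl

/-- The reflection `u ↦ u - 2 (α · u) / (α · α) α` of `U`. -/
def refl (i : ι) : U k c₁ c₂ n ≃ₗ[k] U k c₁ c₂ n := Module.reflection (F.coform_vec i)

/-- The Weyl group `W`, generated by the reflections in all roots. -/
def W : Subgroup (U k c₁ c₂ n ≃ₗ[k] U k c₁ c₂ n) := Subgroup.closure (Set.range F.refl)

/-- The simple reflections of `W`, indexed by the simple roots. -/
def simpleRefl (i : b.support) : F.W := ⟨F.refl i, Subgroup.subset_closure ⟨_, rfl⟩⟩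

/-- The index set `Δ^τ ⊔ Δ_rat` of the folded simple roots. -/
abbrev FoldIdx : Type _ :=
  {i : b.support // tauOp (F.vec i) = F.vec i ∨ i ∈ F.rat}

open Classical in
/-- The element `s_α` (for `α` invariant) or `s_α s_{τα}` (for `α` in `Δ_rat`) of `W`. -/
def pairRefl (i : F.FoldIdx) : F.W :=
  if h : i.1 ∈ F.rat then F.simpleRefl i.1 * F.simpleRefl (F.tauRat ⟨i.1, h⟩)
  else F.simpleRefl i.1

theorem dotU_tauOp (F : FoldedRep b k c₁ c₂ n) (u v : U k c₁ c₂ n) : dotU u (tauOp v) = dotU (tauOp u) v := by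
  rw [← F.tauForm_eq, ← F.tauForm_eq, tauForm_tauOp]

theorem c₂_eq (F : FoldedRep b k c₁ c₂ n) (i : ι) : c₂ = -1 := by
  obtain ⟨j, -⟩ := Function.ne_iff.mp (F.vec_ne_zero i)
  have h := F.tauForm_eq (Pi.single j (tau k c₁ c₂)) (Pi.single j (tau k c₁ c₂))
  have e1 : dotL (Pi.single j (tau k c₁ c₂)) (Pi.single j (tau k c₁ c₂) : U k c₁ c₂ n)
      = tau k c₁ c₂ * tau k c₁ c₂ := by
    rw [dotL, Finset.sum_eq_single j (fun i _ hi => by simp [Pi.single_eq_of_ne hi])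
      (by simp)]
    simp
  have e2 : dotU (Pi.single j (tau k c₁ c₂)) (Pi.single j (tau k c₁ c₂) : U k c₁ c₂ n) = 1 := by
    rw [dotU, Finset.sum_eq_single j (fun i _ hi => by simp [Pi.single_eq_of_ne hi])
      (by simp)]
    simp
  rw [tauForm, e1, e2] at h
  simp at h
  rw [← h, neg_neg]

theorem refl_apply (i : ι) (u : U k c₁ c₂ n) : F.refl i u = u - F.coform i u • F.vec i :=
  Module.reflection_apply _ _

theorem pairRefl_comm (i : F.FoldIdx) (u : U k c₁ c₂ n) :
    (F.pairRefl i : U k c₁ c₂ n ≃ₗ[k] U k c₁ c₂ n) (tauOp u) =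
      tauOp ((F.pairRefl i : U k c₁ c₂ n ≃ₗ[k] U k c₁ c₂ n) u) := by
  by_cases h : i.1 ∈ F.rat
  · have hc := F.c₂_eq i.1
    have hv : F.vec (F.tauRat ⟨i.1, h⟩) = tauOp (F.vec i.1) := F.incl_tauRat ⟨i.1, h⟩
    have hr : dotU (F.vec i.1) (tauOp (F.vec i.1)) = 0 := by
      obtain ⟨-, q, hq⟩ := F.tauRational _ h
      have e : dotL (F.vec i.1) (tauOp (F.vec i.1)) = tau k c₁ c₂ * dotL (F.vec i.1) (F.vec i.1) := by
        rw [dotL, dotL, Finset.mul_sum]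
        exact Finset.sum_congr rfl fun j _ => by
          change _ * (tau k c₁ c₂ * _) = _
          ring
      rw [← F.tauForm_eq, tauForm, e]
      change (tau k c₁ c₂ * dotL (F.incl _) (F.incl _)).re = 0
      rw [← hq]
      simp
    have hn : dotU (tauOp (F.vec i.1)) (tauOp (F.vec i.1)) = dotU (F.vec i.1) (F.vec i.1) := by
      have e : tauOp (tauOp (F.vec i.1)) = c₁ • tauOp (F.vec i.1) + (-c₂) • F.vec i.1 := by
        rw [tauOp_tauOp, neg_smul, sub_eq_add_neg]
      rw [← F.dotU_tauOp, e, dotU_add_right, dotU_smul_right, dotU_smul_right, hr]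
      have hc' : ∀ a q : k, a = -1 → c₁ * 0 + -a * q = q := by rintro a q rfl; ring
      exact hc' _ _ hc
    have hcf : ∀ u, F.coform (F.tauRat ⟨i.1, h⟩) u = F.coform i.1 (tauOp u) := fun u =>
      Subtype.ext <| by
        change 2 * (dotU (F.vec _) u : ℝ) / (dotU (F.vec _) (F.vec _) : ℝ) =
          2 * (dotU (F.vec _) (tauOp u) : ℝ) / (dotU (F.vec _) (F.vec _) : ℝ)
        rw [hv, hn, F.dotU_tauOp]
    have h0 : F.coform i.1 (tauOp (F.vec i.1)) = 0 := Subtype.ext <| by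
      change 2 * (dotU (F.vec i.1) (tauOp (F.vec i.1)) : ℝ) / _ = _
      rw [hr]; simp
    simp only [pairRefl, h, dif_pos, Subgroup.coe_mul, LinearEquiv.mul_apply]
    simp only [simpleRefl, refl_apply, hcf, hv, map_sub, map_smul, h0, tauOp_tauOp, hc]
    module
  · have hi : tauOp (F.vec i.1) = F.vec i.1 := i.2.resolve_right h
    have hcf : F.coform i.1 (tauOp u) = F.coform i.1 u := Subtype.ext <| by
      change 2 * (dotU (F.vec i.1) (tauOp u) : ℝ) / _ = 2 * (dotU (F.vec i.1) u : ℝ) / _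
      rw [F.dotU_tauOp, hi]
    simp only [pairRefl, h, dif_neg, not_false_eq_true, simpleRefl, refl_apply, map_sub, map_smul,
      hcf, hi]

/-- The folded simple reflections `R_α` of `U_τ`. -/
def foldRefl (i : F.FoldIdx) : Utau k c₁ c₂ n ≃ₗ[L k c₁ c₂] Utau k c₁ c₂ n :=
  restrictUtau (F.pairRefl i) (F.pairRefl_comm i)

/-- The folded group `W_τ`. -/
def Wtau : Subgroup (Utau k c₁ c₂ n ≃ₗ[L k c₁ c₂] Utau k c₁ c₂ n) :=
  Subgroup.closure (Set.range F.foldRefl)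

/-- The simple reflections of `W_τ`, indexed by `Δ^τ ⊔ Δ_rat`. -/
def simpleReflTau (i : F.FoldIdx) : F.Wtau := ⟨F.foldRefl i, Subgroup.subset_closure ⟨i, rfl⟩⟩

theorem pullback_foldRefl (i : F.FoldIdx) :
    pullback F.isUnit_disc (F.foldRefl i) = (F.pairRefl i : U k c₁ c₂ n ≃ₗ[k] U k c₁ c₂ n) := by
  ext1 u
  change (tauProjEquiv F.isUnit_disc).symm
    (restrictUtau (F.pairRefl i).1 (F.pairRefl_comm i) (tauProj u)) = _
  rw [restrictUtau_tauProj]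
  exact (tauProjEquiv F.isUnit_disc).symm_apply_apply _

/-- The embedding `W_τ → W` of groups: `ε(u)` is the automorphism of `U` that corresponds to `u`
under the projection `U ≃ U_τ`; on generators, it sends `R_α` to `s_α`, or to `s_α s_{τα}`. -/
def embed : F.Wtau →* F.W :=
  ((pullback F.isUnit_disc).comp F.Wtau.subtype).codRestrict F.W <| by
    rintro ⟨g, hg⟩
    change pullback F.isUnit_disc g ∈ F.W
    change g ∈ F.W.comap (pullback F.isUnit_disc)
    refine (Subgroup.closure_le _).2 ?_ hg
    rintro _ ⟨i, rfl⟩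
    change pullback F.isUnit_disc (F.foldRefl i) ∈ F.W
    rw [pullback_foldRefl]
    exact (F.pairRefl i).2

theorem embed_simpleReflTau (i : F.FoldIdx) : F.embed (F.simpleReflTau i) = F.pairRefl i :=
  Subtype.ext (F.pullback_foldRefl i)

theorem embed_injective : Function.Injective F.embed := by
  intro g h hgh
  have e : pullback F.isUnit_disc g.1 = pullback F.isUnit_disc h.1 := congrArg Subtype.val hgh
  refine Subtype.ext (LinearEquiv.ext fun x => ?_)
  have e1 := LinearEquiv.congr_fun e ((tauProjEquiv F.isUnit_disc).symm x)
  have e2 := (tauProjEquiv F.isUnit_disc).symm.injective e1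
  change g.1 (tauProjEquiv F.isUnit_disc _) = h.1 (tauProjEquiv F.isUnit_disc _) at e2
  rwa [LinearEquiv.apply_symm_apply] at e2

/-! ### The combinatorial folding map and the folding subset -/

theorem mem_foldIdx_of_notMem_range {i : b.support} (h : ¬ ∃ j, F.tauRat j = i) :
    tauOp (F.vec i) = F.vec i ∨ i ∈ F.rat := by
  have := F.partition.symm ▸ Set.mem_univ i
  rcases this with h' | h'
  · exact h'
  · exact absurd h' h

open Classical in
/-- The combinatorial folding map `φ`, sending `s_α` and `s_{τα}` to `R_α` for `α` in
`Δ^τ ⊔ Δ_rat`. The sets of simple reflections are identified with their index sets. -/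
def phi (i : b.support) : F.FoldIdx :=
  if h : ∃ j, F.tauRat j = i then ⟨(h.choose : F.rat).1, Or.inr h.choose.2⟩
  else ⟨i, F.mem_foldIdx_of_notMem_range h⟩

theorem tauRat_injective : Function.Injective F.tauRat := by
  intro i j h
  have h1 : F.vec (F.tauRat i) = F.vec (F.tauRat j) := by rw [h]
  have hu : IsUnit (tau k c₁ c₂) := by
    refine IsUnit.of_mul_eq_one (tau k c₁ c₂ - c₁ • 1) ?_
    rw [mul_sub, tau_mul_tau, F.c₂_eq i.1]
    simp
  have h2 : tau k c₁ c₂ • F.vec i.1 = tau k c₁ c₂ • F.vec j.1 := by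
    have := h1
    rw [vec, F.incl_tauRat i, vec, F.incl_tauRat j] at this
    exact this
  have h3 : F.vec i.1 = F.vec j.1 := hu.smul_left_cancel.1 h2
  have h4 : (P.coroot i.1) = P.coroot j.1 := by
    apply P.toLinearMap.flip.toPerfPair.injective
    ext x
    have e1 := F.coroot_eq i.1 x
    have e2 := F.coroot_eq j.1 x
    change _ = 2 * (dotU (F.vec _) _ : ℝ) / (dotU (F.vec _) (F.vec _) : ℝ) at e1 e2
    rw [h3, ← e2] at e1
    exact_mod_cast e1
  exact Subtype.ext (Subtype.ext (P.coroot.injective h4))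

theorem phi_tauRat (i : F.rat) : F.phi (F.tauRat i) = ⟨i.1, Or.inr i.2⟩ := by
  have h : ∃ j, F.tauRat j = F.tauRat i := ⟨i, rfl⟩
  rw [phi, dif_pos h]
  have e := congrArg Subtype.val (F.tauRat_injective h.choose_spec)
  exact Subtype.ext e

theorem phi_foldIdx (i : F.FoldIdx) : F.phi i.1 = i := by
  have h : ¬ ∃ j, F.tauRat j = i.1 := by
    intro h
    rcases i.2 with h' | h'
    · exact Set.disjoint_left.1 F.disjoint_inv_tauRat h' h
    · exact Set.disjoint_left.1 F.disjoint_rat_tauRat h' h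
  rw [phi, dif_neg h]

/-- The folding subset `W^φ`. -/
def foldingSubset : Set F.W :=
  {w | w = 1 ∨
    ((∀ l ∈ redWords F.simpleRefl w, l.map F.phi ∈ allRedWords F.simpleReflTau) ∧
      (∀ l ∈ redWords F.simpleRefl w, ∀ l' ∈ redWords F.simpleRefl w,
        ∃ u : F.Wtau, l.map F.phi ∈ redWords F.simpleReflTau u ∧
          l'.map F.phi ∈ redWords F.simpleReflTau u))}

open Classical in
/-- The map `W^φ → W_τ` induced by `φ`: apply `φ` letter by letter to any reduced word of `w`
(such a word always exists). -/
def phiBar (w : F.foldingSubset) : F.Wtau :=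
  if h : (redWords F.simpleRefl w.1).Nonempty then
    wordProd F.simpleReflTau (h.some.map F.phi)
  else 1

theorem phiBar_eq (w : F.foldingSubset) {l : List b.support}
    (hl : l ∈ redWords F.simpleRefl w.1) :
    F.phiBar w = wordProd F.simpleReflTau (l.map F.phi) := by
  have h : (redWords F.simpleRefl w.1).Nonempty := ⟨l, hl⟩
  rw [phiBar, dif_pos h]
  rcases w.2 with h1 | ⟨-, h2⟩
  · have h0 : genLength F.simpleRefl w.1 = 0 :=
      Nat.sInf_eq_zero.2 (Or.inl ⟨[], rfl, by rw [h1]; rfl⟩)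
    have e : ∀ l ∈ redWords F.simpleRefl w.1, l = [] := fun l hl =>
      List.length_eq_zero_iff.1 (hl.2.trans h0)
    rw [e _ hl, e _ h.some_mem]
  · obtain ⟨u, hu, hu'⟩ := h2 _ h.some_mem _ hl
    exact hu.1.trans hu'.1.symm

end FoldedRep

end Folded

end

end Folding

/-! ### Strong exchange and the Bruhat order for a group with half-spaces -/

section HalfSpaces

variable {G : Type*} [Group G] {I : Type*}

/-! The theorem rests on the subword description of the Bruhat order, which is needed in $W$ and in
$W_\tau$. Both groups are handled by one axiomatic argument: `HalfSpaces` abstracts the signs of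
images of simple roots, and strong exchange, the lifting property and the subword property follow
from it. For $W$ the sign of $w\alpha$ is read off the cone of the simple roots. For $W_\tau$ it is
the sign of $\varepsilon(u)\alpha$. The equality of the two forms forces $c_2=-1$, so $T^2=c_1T+1$,
and according to the sign of $c_1$ either $T$ or $T^{-1}=T-c_1$ preserves the cone. Hence $\alpha$
and $T\alpha$ have the same sign, and for $\alpha\in\Delta_{rat}$ the product $s_\alpha s_{T\alpha}$
of commuting reflections makes no positive roots negative other than $\alpha$ and $T\alpha$.

Suppose (C1)–(C3), and let $l$ be a reduced word of $w$. Let $u'$ be the Demazure product of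
$\varphi(l)$: a letter is multiplied in only if it raises the length. By lifting,
$w\le\varepsilon(u')$ (`exists_bruhatLE_toW`), and $l_\tau(u')\le|l|$, with equality only if no
letter was skipped. By (C3) $u\le u'$, and since $l_\tau(u)=|l|$ this gives $u=u'$, so $\varphi(l)$
is a reduced word of $u$.

Conversely, if $\varphi(l)$ is a reduced word of $u$, no letter is skipped and $w\le\varepsilon(u)$
(`bruhatLE_toW_of_reduced`). If $w\le\varepsilon(u')$, expand a reduced word of $u'$ into simple
reflections of $W$ and choose a reduced word of $w$ inside it. Its folding lies in the word of $u'$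
with some letters doubled, but a reduced word cannot use both copies of a doubled letter, so $u\le
u'$ (`bruhatLE_of_bruhatLE_toW`). -/

/-- A criterion for involutions `s` generating `G` to be the simple reflections of a Coxeter group.
The predicate `pos g i` plays the role of "`g` sends the `i`-th simple root to a positive root". -/
structure HalfSpaces (s : I → G) (pos : G → I → Prop) : Prop where
  mul_self : ∀ i, s i * s i = 1
  exists_word : ∀ g, ∃ l, wordProd s l = g
  pos_mul : ∀ g i, pos (g * s i) i ↔ ¬ pos g i
  conj_eq : ∀ g i j, pos g i → ¬ pos (s j * g) i → g * s i * g⁻¹ = s j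

@[simp] theorem wordProd_nil (s : I → G) : wordProd s [] = 1 := rfl

@[simp] theorem wordProd_cons (s : I → G) (i : I) (l : List I) :
    wordProd s (i :: l) = s i * wordProd s l := by simp [wordProd]

@[simp] theorem wordProd_append (s : I → G) (l l' : List I) :
    wordProd s (l ++ l') = wordProd s l * wordProd s l' := by simp [wordProd]

theorem genLength_wordProd_le (s : I → G) (l : List I) : genLength s (wordProd s l) ≤ l.length :=
  Nat.sInf_le ⟨l, rfl, rfl⟩

@[simp] theorem genLength_one (s : I → G) : genLength s 1 = 0 :=
  Nat.le_zero.1 (genLength_wordProd_le s [])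

theorem bruhatLE.genLength_le {s : I → G} {g h : G} (hgh : bruhatLE s g h) :
    genLength s g ≤ genLength s h := by
  induction hgh with
  | refl => rfl
  | tail _ hs ih =>
    obtain ⟨t, -, -, hlt⟩ := hs
    exact ih.trans hlt.le

theorem bruhatLE.eq_of_genLength_le {s : I → G} {g h : G} (hgh : bruhatLE s g h)
    (hl : genLength s h ≤ genLength s g) : g = h := by
  rcases Relation.ReflTransGen.cases_tail hgh with rfl | ⟨x, hx, t, -, -, hlt⟩
  · rfl
  · exact absurd (hlt.trans_le hl) (not_lt.2 (bruhatLE.genLength_le hx))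

namespace HalfSpaces

variable {s : I → G} {pos : G → I → Prop} (H : HalfSpaces s pos)
include H

theorem exists_mem_redWords (g : G) : ∃ l, l ∈ redWords s g := by
  obtain ⟨l, hl⟩ := H.exists_word g
  obtain ⟨l', h1, h2⟩ := Nat.sInf_mem
    (⟨l.length, l, rfl, hl⟩ : {m | ∃ l : List I, l.length = m ∧ wordProd s l = g}.Nonempty)
  exact ⟨l', h2, h1⟩

theorem mul_mul_cancel (g : G) (i : I) : g * s i * s i = g := by
  rw [mul_assoc, H.mul_self, mul_one]

theorem inv_eq (i : I) : (s i)⁻¹ = s i := inv_eq_of_mul_eq_one_left (H.mul_self i)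

theorem genLength_mul_le (g : G) (i : I) : genLength s (g * s i) ≤ genLength s g + 1 := by
  obtain ⟨l, rfl, h2⟩ := H.exists_mem_redWords g
  rw [← h2]
  simpa using genLength_wordProd_le s (l ++ [i])

theorem genLength_le_mul (g : G) (i : I) : genLength s g ≤ genLength s (g * s i) + 1 := by
  simpa only [H.mul_mul_cancel] using H.genLength_mul_le (g * s i) i

/-- A change from negative to positive becomes the opposite change when `conj_eq` is applied to `s j
* g`. -/
theorem conj_eq_of_ne (g : G) (i j : I) (h : ¬ (pos g i ↔ pos (s j * g) i)) :
    g * s i * g⁻¹ = s j := by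
  by_cases hg : pos g i
  · exact H.conj_eq g i j hg fun h' => h (iff_of_true hg h')
  · have h1 : pos (s j * g) i := by
      by_contra h'
      exact h (iff_of_false hg h')
    have h2 := H.conj_eq (s j * g) i j h1 (by rwa [← mul_assoc, H.mul_self, one_mul])
    rw [mul_inv_rev, ← mul_assoc, mul_inv_eq_iff_eq_mul, mul_assoc, mul_assoc, ← mul_assoc g] at h2
    exact mul_left_cancel h2

/-- Multiply `x` on the left by the letters of `l`, starting with the last. The sign changes at some
letter `j`; there `s j` is the conjugate of `s i` by the element reached so far, so multiplication
by the reflection `x * s i * x⁻¹` cancels `j`. -/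
theorem exists_erase_of_flip (x : G) (i : I) (l : List I)
    (h : ¬ (pos x i ↔ pos (wordProd s l * x) i)) :
    ∃ l₁ j l₂, l = l₁ ++ j :: l₂ ∧ wordProd s l * (x * s i * x⁻¹) = wordProd s (l₁ ++ l₂) := by
  induction l with
  | nil => simp at h
  | cons j l ih =>
    by_cases h' : pos x i ↔ pos (wordProd s l * x) i
    · rw [h', wordProd_cons, mul_assoc] at h
      have h2 := H.conj_eq_of_ne _ _ _ h
      refine ⟨[], j, l, rfl, ?_⟩
      rw [wordProd_cons, ← h2]
      calc _ = wordProd s l * x * (s i * s i) * x⁻¹ := by group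
        _ = _ := by rw [H.mul_self]; simp
    · obtain ⟨l₁, j', l₂, rfl, h2⟩ := ih h'
      exact ⟨j :: l₁, j', l₂, rfl, by rw [wordProd_cons, mul_assoc, h2]; simp⟩

theorem genLength_mul_lt_of_flip (g x : G) (i : I) (h : ¬ (pos x i ↔ pos (g * x) i)) :
    genLength s (g * (x * s i * x⁻¹)) < genLength s g := by
  obtain ⟨l, rfl, h2⟩ := H.exists_mem_redWords g
  obtain ⟨l₁, j, l₂, rfl, h3⟩ := H.exists_erase_of_flip x i l h
  rw [h3, ← h2]
  refine (genLength_wordProd_le s _).trans_lt ?_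
  simp

/-- By `pos_mul`, absence of a flip for `g` is a flip for `g * t`, where `t = x * s i * x⁻¹`, and
`t` is an involution. -/
theorem genLength_lt_mul_of_not_flip (g x : G) (i : I) (h : pos x i ↔ pos (g * x) i) :
    genLength s g < genLength s (g * (x * s i * x⁻¹)) := by
  have h2 : g * (x * s i * x⁻¹) * x = g * x * s i := by group
  have h3 : g * (x * s i * x⁻¹) * (x * s i * x⁻¹) = g := by
    calc _ = g * (x * (s i * s i) * x⁻¹) := by group
      _ = g := by rw [H.mul_self]; simp
  have := H.genLength_mul_lt_of_flip (g * (x * s i * x⁻¹)) x i (by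
    rw [h2, H.pos_mul, h]; tauto)
  rwa [h3] at this

/-- The strong exchange property. -/
theorem exists_erase {t : G} (ht : t ∈ genReflections s) (l : List I)
    (h : genLength s (wordProd s l * t) < genLength s (wordProd s l)) :
    ∃ l₁ j l₂, l = l₁ ++ j :: l₂ ∧ wordProd s l * t = wordProd s (l₁ ++ l₂) := by
  obtain ⟨x, i, rfl⟩ := ht
  exact H.exists_erase_of_flip x i l fun h' => (H.genLength_lt_mul_of_not_flip _ x i h').not_gt h

theorem genLength_mul_ne {t : G} (ht : t ∈ genReflections s) (g : G) :
    genLength s (g * t) ≠ genLength s g := by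
  obtain ⟨x, i, rfl⟩ := ht
  by_cases h : pos x i ↔ pos (g * x) i
  · exact (H.genLength_lt_mul_of_not_flip g x i h).ne'
  · exact (H.genLength_mul_lt_of_flip g x i h).ne

omit H in
theorem simple_mem (i : I) : s i ∈ genReflections s := ⟨1, i, by simp⟩

theorem genLength_lt_mul_iff (h1 : ∀ i, pos 1 i) (g : G) (i : I) :
    genLength s g < genLength s (g * s i) ↔ pos g i := by
  have h2 : (1 : G) * s i * 1⁻¹ = s i := by simp
  by_cases h : pos g i
  · have := H.genLength_lt_mul_of_not_flip g 1 i (by simpa [h1] using h)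
    rw [h2] at this
    exact iff_of_true this h
  · have := H.genLength_mul_lt_of_flip g 1 i (by simpa [h1] using h)
    rw [h2] at this
    exact iff_of_false this.not_gt h

/-! ### Deletion, lifting and the subword property -/

theorem exists_sublist_mem_redWords (l : List I) : ∃ l', l'.Sublist l ∧
    l' ∈ redWords s (wordProd s l) := by
  induction l using List.reverseRecOn with
  | nil => exact ⟨[], List.Sublist.refl _, rfl, by simp⟩
  | append_singleton l i ih =>
    obtain ⟨l', hl, h1, h2⟩ := ih
    have e : wordProd s (l ++ [i]) = wordProd s l' * s i := by simp [h1]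
    rw [← h1] at h2
    rw [e]
    rcases (H.genLength_mul_ne (simple_mem i) (wordProd s l')).lt_or_gt with h | h
    · obtain ⟨l₁, j, l₂, rfl, h3⟩ := H.exists_erase (simple_mem i) l' h
      refine ⟨l₁ ++ l₂, ?_, h3.symm, ?_⟩
      · refine ((List.Sublist.append_left (List.sublist_cons_self j l₂) l₁).trans hl).trans ?_
        exact List.sublist_append_left l [i]
      -- Deleting a letter shortens the word by one, and a generator lowers the length by at most
      -- one, so the new word is still reduced.
      · refine le_antisymm ?_ (h3 ▸ genLength_wordProd_le s _)
        have := H.genLength_le_mul (wordProd s (l₁ ++ j :: l₂)) i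
        rw [← h2] at this
        simp only [List.length_append, List.length_cons] at this ⊢
        omega
    · refine ⟨l' ++ [i], hl.append_right [i], by simp, ?_⟩
      have := H.genLength_mul_le (wordProd s l') i
      simp only [List.length_append, List.length_singleton]
      omega

/-- Each step down a Bruhat chain deletes a letter by strong exchange. That needs no reducedness, so
`l` may be any word of `h`; a reduced subword is extracted at the end. -/
theorem exists_sublist_of_bruhatLE {g h : G} (hgh : bruhatLE s g h) (l : List I)
    (hl : wordProd s l = h) : ∃ l', l'.Sublist l ∧ l' ∈ redWords s g := by
  suffices ∃ l', l'.Sublist l ∧ wordProd s l' = g by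
    obtain ⟨l', h1, rfl⟩ := this
    obtain ⟨l'', h2, h3⟩ := H.exists_sublist_mem_redWords l'
    exact ⟨l'', h2.trans h1, h3⟩
  induction hgh using Relation.ReflTransGen.head_induction_on with
  | refl => exact ⟨l, List.Sublist.refl _, hl⟩
  | @head g' _ hs _ ih =>
    obtain ⟨t, ht, rfl, hlt⟩ := hs
    obtain ⟨l', h1, h2⟩ := ih
    have h3 : t * t = 1 := by
      obtain ⟨x, i, rfl⟩ := ht
      calc _ = x * (s i * s i) * x⁻¹ := by group
        _ = 1 := by rw [H.mul_self]; simp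
    have h4 : wordProd s l' * t = g' := by rw [h2, mul_assoc, h3, mul_one]
    obtain ⟨l₁, j, l₂, rfl, h5⟩ := H.exists_erase ht l' (by rwa [h4, h2])
    exact ⟨l₁ ++ l₂, (List.Sublist.append_left (List.sublist_cons_self j l₂) l₁).trans h1,
      by rw [← h5, h4]⟩

/-- The lifting property for one step. If `t ≠ s i`, the reflection `s i * t * s i` carries `g * s
i` to `g * t * s i`, and the point is that it raises the length. -/
theorem bruhatLE_mul_of_step {g t : G} (ht : t ∈ genReflections s) (i : I)
    (hlt : genLength s g < genLength s (g * t)) :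
    bruhatLE s (g * s i) (g * t) ∨ bruhatLE s (g * s i) (g * t * s i) := by
  by_cases hti : t = s i
  · rw [hti]; exact Or.inl .refl
  refine Or.inr (.single ⟨s i * t * s i, ?_, ?_, ?_⟩)
  · obtain ⟨x, j, rfl⟩ := ht
    exact ⟨s i * x, j, by rw [mul_inv_rev, H.inv_eq]; group⟩
  · rw [← mul_assoc, ← mul_assoc, H.mul_mul_cancel]
  · have ht' : s i * t * s i ∈ genReflections s := by
      obtain ⟨x, j, rfl⟩ := ht
      exact ⟨s i * x, j, by rw [mul_inv_rev, H.inv_eq]; group⟩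
    have e : g * s i * (s i * t * s i) = g * t * s i := by
      rw [← mul_assoc, ← mul_assoc, H.mul_mul_cancel]
    have hne := H.genLength_mul_ne ht' (g * s i)
    rw [e] at hne
    refine lt_of_le_of_ne (not_lt.1 fun hgt => ?_) hne.symm
    obtain ⟨l, rfl, hl⟩ := H.exists_mem_redWords g
    have e2 : wordProd s l * s i = wordProd s (l ++ [i]) := by simp
    rw [← e, e2] at hgt
    obtain ⟨l₁, j, l₂, h1, h2⟩ := H.exists_erase ht' _ hgt
    rw [← e2, e] at h2
    -- If the length dropped, strong exchange would delete a letter of `l ++ [i]`. Deleting the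
    -- appended `i` gives `t = s i`; deleting a letter of the reduced word `l` makes `g * t` shorter
    -- than `g`.
    rcases List.eq_nil_or_concat l₂ with rfl | ⟨l₃, k, rfl⟩
    · obtain ⟨rfl, -⟩ := List.append_inj' h1 rfl
      rw [List.append_nil, mul_assoc, mul_eq_left] at h2
      exact hti (mul_right_cancel (h2.trans (H.mul_self i).symm))
    · rw [List.concat_eq_append, ← List.cons_append, ← List.append_assoc] at h1
      obtain ⟨rfl, h3⟩ := List.append_inj' h1 rfl
      obtain rfl : i = k := by simpa using h3
      rw [List.concat_eq_append, ← List.append_assoc, wordProd_append _ (l₁ ++ l₃)] at h2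
      have h4 : wordProd s (l₁ ++ j :: l₃) * t = wordProd s (l₁ ++ l₃) := by
        refine mul_right_cancel (b := s i) ?_
        simpa using h2
      rw [h4, ← hl] at hlt
      have := hlt.trans_le (genLength_wordProd_le s _)
      simp at this

theorem bruhatLE_mul_or {g h : G} (hgh : bruhatLE s g h) (i : I) :
    bruhatLE s (g * s i) h ∨ bruhatLE s (g * s i) (h * s i) := by
  induction hgh with
  | refl => exact Or.inr .refl
  | tail _ hs ih =>
    have hs' := hs
    obtain ⟨t, ht, rfl, hlt⟩ := hs
    rcases ih with h1 | h1
    · exact Or.inl (h1.tail hs')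
    · exact (H.bruhatLE_mul_of_step ht i hlt).imp h1.trans h1.trans

omit H in
theorem bruhatLE_mul_self {g : G} {i : I} (h : genLength s g < genLength s (g * s i)) :
    bruhatLE s g (g * s i) := .single ⟨s i, simple_mem i, rfl, h⟩

theorem bruhatLE_mul_mul {g h : G} (hgh : bruhatLE s g h) {i : I}
    (hi : genLength s h < genLength s (h * s i)) : bruhatLE s (g * s i) (h * s i) :=
  (H.bruhatLE_mul_or hgh i).elim (fun h1 => h1.trans (bruhatLE_mul_self hi)) id

theorem bruhatLE_mul_left {g h : G} (hgh : bruhatLE s g h) {i : I}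
    (hi : genLength s (h * s i) < genLength s h) : bruhatLE s (g * s i) h := by
  refine (H.bruhatLE_mul_or hgh i).elim id fun h1 => h1.trans ?_
  have := bruhatLE_mul_self (s := s) (g := h * s i) (i := i) (by rwa [H.mul_mul_cancel])
  rwa [H.mul_mul_cancel] at this

/-- Replacing a non-reduced factor by a reduced word would shorten the whole word. -/
theorem mem_redWords_of_append {l l' : List I}
    (h : (l ++ l').length = genLength s (wordProd s (l ++ l'))) :
    l.length = genLength s (wordProd s l) ∧ l'.length = genLength s (wordProd s l') := by
  obtain ⟨m, h1, h2⟩ := H.exists_mem_redWords (wordProd s l)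
  obtain ⟨m', h1', h2'⟩ := H.exists_mem_redWords (wordProd s l')
  have h3 := genLength_wordProd_le s (m ++ m')
  rw [wordProd_append, h1, h1', ← wordProd_append, ← h] at h3
  have h4 := genLength_wordProd_le s l
  have h5 := genLength_wordProd_le s l'
  simp only [List.length_append] at h3
  omega

/-- The converse half of the subword property: the last letter is an ascent, so it may be dropped,
or kept by lifting. -/
theorem bruhatLE_of_sublist {l l' : List I} (hs : l'.Sublist l)
    (hl : l.length = genLength s (wordProd s l)) :
    bruhatLE s (wordProd s l') (wordProd s l) := by
  induction l using List.reverseRecOn generalizing l' with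
  | nil => rw [List.sublist_nil.1 hs]; exact .refl
  | append_singleton l i ih =>
    obtain ⟨a, b, rfl, ha, hb⟩ := List.sublist_append_iff.1 hs
    have h1 := (H.mem_redWords_of_append hl).1
    have h2 := ih ha h1
    have h3 : genLength s (wordProd s l) < genLength s (wordProd s l * s i) := by
      have : wordProd s (l ++ [i]) = wordProd s l * s i := by simp
      rw [this, List.length_append, h1] at hl
      rw [← hl]; simp
    rw [wordProd_append, wordProd_append]
    rcases List.sublist_singleton.1 hb with rfl | rfl
    · rw [wordProd_nil, mul_one, wordProd_cons, wordProd_nil, mul_one]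
      exact h2.trans (bruhatLE_mul_self h3)
    · rw [wordProd_cons, wordProd_nil, mul_one]
      exact H.bruhatLE_mul_mul h2 h3

end HalfSpaces

end HalfSpaces

/-! ### Root combinatorics of a folded representation -/

namespace Folding

namespace FoldedRep

noncomputable section

variable {ι X Y : Type*} [AddCommGroup X] [AddCommGroup Y] {P : RootDatum ι X Y}
variable {b : P.Base} {k : Subring ℝ} {c₁ c₂ : k} {n : ℕ} (F : FoldedRep b k c₁ c₂ n)

theorem dotU_comm (u v : U k c₁ c₂ n) : dotU u v = dotU v u :=
  Finset.sum_congr rfl fun _ _ => by ring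

theorem dotU_sub_right (u v w : U k c₁ c₂ n) : dotU u (v - w) = dotU u v - dotU u w := by
  rw [eq_sub_iff_add_eq, ← dotU_add_right, sub_add_cancel]

theorem coform_mul (i : ι) (u : U k c₁ c₂ n) :
    F.coform i u * dotU (F.vec i) (F.vec i) = 2 * dotU (F.vec i) u := by
  apply Subtype.ext
  change 2 * (dotU (F.vec i) u : ℝ) / (dotU (F.vec i) (F.vec i) : ℝ) * _ = 2 * (dotU (F.vec i) u : ℝ)
  exact div_mul_cancel₀ _ (F.dot_vec_ne_zero i)

theorem dotU_refl (i : ι) (u v : U k c₁ c₂ n) :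
    dotU (F.refl i u) (F.refl i v) = dotU u v := by
  have h1 := F.coform_mul i u
  rw [refl_apply, refl_apply, dotU_sub_right, dotU_smul_right, dotU_comm (u - _) v,
    dotU_comm (u - _) (F.vec i), dotU_sub_right, dotU_sub_right, dotU_smul_right, dotU_smul_right,
    dotU_comm v u, dotU_comm v (F.vec i)]
  have h2 := F.coform_mul i v
  have h3 : F.coform i v * dotU (F.vec i) u = F.coform i u * dotU (F.vec i) v := by
    refine mul_left_cancel₀ (two_ne_zero (α := k)) ?_
    linear_combination (F.coform i u) * h2 - (F.coform i v) * h1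
  linear_combination (F.coform i v) * h1 + h3

theorem dotU_W (w : F.W) (u v : U k c₁ c₂ n) : dotU (w.1 u) (w.1 v) = dotU u v := by
  obtain ⟨w, hw⟩ := w
  induction hw using Subgroup.closure_induction generalizing u v with
  | mem _ h => obtain ⟨i, rfl⟩ := h; exact F.dotU_refl i u v
  | one => rfl
  | mul x y _ _ hx hy => exact (hx _ _).trans (hy _ _)
  | inv x _ hx =>
    have := hx (x⁻¹ u) (x⁻¹ v)
    change dotU ((x * x⁻¹) u) ((x * x⁻¹) v) = _ at this
    rw [mul_inv_cancel] at this
    exact this.symm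

/-- The reflection in a root, as an element of `W`. -/
def rootRefl (i : ι) : F.W := ⟨F.refl i, Subgroup.subset_closure ⟨i, rfl⟩⟩

/-- Elements of $W$ preserve the dot product, so `w` transports the linear form of the reflection
along with its root. -/
theorem conj_rootRefl (w : F.W) {i j : ι} (h : w.1 (F.vec i) = F.vec j) :
    w * F.rootRefl i * w⁻¹ = F.rootRefl j := by
  rw [mul_inv_eq_iff_eq_mul]
  refine Subtype.ext (LinearEquiv.ext fun u => ?_)
  change w.1 (F.refl i u) = F.refl j (w.1 u)
  have hc : F.coform i u = F.coform j (w.1 u) := Subtype.ext <| by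
    change 2 * (dotU (F.vec i) u : ℝ) / (dotU (F.vec i) (F.vec i) : ℝ) =
      2 * (dotU (F.vec j) (w.1 u) : ℝ) / (dotU (F.vec j) (F.vec j) : ℝ)
    rw [← h, dotU_W, dotU_W]
  rw [refl_apply, refl_apply, map_sub, map_smul, hc, h]

/-- The vector of a root determines its coroot by `coroot_eq`. -/
theorem vec_injective : Function.Injective F.vec := by
  intro i j h
  apply P.coroot.injective
  apply P.toLinearMap.flip.toPerfPair.injective
  ext x
  have e1 := F.coroot_eq i x
  have e2 := F.coroot_eq j x
  change _ = 2 * (dotU (F.vec _) _ : ℝ) / (dotU (F.vec _) (F.vec _) : ℝ) at e1 e2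
  rw [h, ← e2] at e1
  exact_mod_cast e1

theorem coform_vec_eq (i j : ι) : F.coform i (F.vec j) = (P.pairing j i : k) := Subtype.ext <| by
  have := F.coroot_eq i (P.root j)
  rw [Subring.coe_intCast]
  exact this.symm

theorem refl_vec (i j : ι) : F.refl i (F.vec j) = F.vec (P.reflectionPerm i j) := by
  rw [refl_apply, coform_vec_eq, vec, vec, vec, P.root_reflectionPerm, P.reflection_apply_root,
    TensorProduct.tmul_sub, map_sub, ← TensorProduct.smul_tmul, ← zsmul_one]
  congr 1
  rw [← map_smul, TensorProduct.smul_tmul', smul_eq_mul, mul_one]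

theorem exists_vec (w : F.W) (i : ι) : ∃ j, w.1 (F.vec i) = F.vec j := by
  obtain ⟨w, hw⟩ := w
  induction hw using Subgroup.closure_induction_left generalizing i with
  | one => exact ⟨i, rfl⟩
  | mul_left x hx y _ h =>
    obtain ⟨j, rfl⟩ := hx
    obtain ⟨m, hm⟩ := h i
    exact ⟨_, (congrArg (F.refl j) hm).trans (F.refl_vec j m)⟩
  | inv_mul_cancel x hx y _ h =>
    obtain ⟨j, rfl⟩ := hx
    obtain ⟨m, hm⟩ := h i
    exact ⟨_, (congrArg (F.refl j) hm).trans (F.refl_vec j m)⟩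

theorem rootRefl_mul_self (i : ι) : F.rootRefl i * F.rootRefl i = 1 := by
  refine Subtype.ext (LinearEquiv.ext fun u => ?_)
  exact Module.involutive_reflection (F.coform_vec i) u

/-! ### The positive cone -/

/-- The cone spanned by the simple roots over the nonnegative elements of `k`. -/
def cone : AddSubmonoid (U k c₁ c₂ n) where
  carrier := {v | ∃ c : b.support → k, (∀ i, 0 ≤ c i) ∧ v = ∑ i, c i • F.vec i}
  zero_mem' := ⟨0, fun _ => le_rfl, by simp⟩
  add_mem' := by
    rintro _ _ ⟨c, hc, rfl⟩ ⟨d, hd, rfl⟩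
    exact ⟨c + d, fun i => add_nonneg (hc i) (hd i), by simp [add_smul, Finset.sum_add_distrib]⟩

theorem smul_mem_cone {a : k} (ha : 0 ≤ a) {v : U k c₁ c₂ n} (hv : v ∈ F.cone) :
    a • v ∈ F.cone := by
  obtain ⟨c, hc, rfl⟩ := hv
  exact ⟨fun i => a * c i, fun i => mul_nonneg ha (hc i), by simp [Finset.smul_sum, mul_smul]⟩

theorem simple_mem_cone (i : b.support) : F.vec i ∈ F.cone := by
  classical
  exact ⟨Pi.single i 1, fun j => by by_cases h : j = i <;> simp [h],
    by simp [Pi.single_apply]⟩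

theorem linearIndependent_vec : LinearIndependent k fun i : b.support => F.vec i := by
  have h1 : LinearIndependent k fun i : b.support => (1 : k) ⊗ₜ[ℤ] P.root i :=
    Module.Flat.linearIndependent_one_tmul b.linearIndepOn_root
  exact h1.map' F.incl (LinearMap.ker_eq_bot.2 F.incl_injective)

theorem eq_zero_of_mem_cone {v : U k c₁ c₂ n} (h : v ∈ F.cone) (h' : -v ∈ F.cone) : v = 0 := by
  obtain ⟨c, hc, rfl⟩ := h
  obtain ⟨d, hd, h⟩ := h'
  have h2 : ∑ i, (c i + d i) • F.vec (i : b.support) = 0 := by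
    simp only [add_smul, Finset.sum_add_distrib, ← h, add_neg_cancel]
  have h3 := Fintype.linearIndependent_iff.1 F.linearIndependent_vec _ h2
  refine Finset.sum_eq_zero fun i _ => ?_
  have h4 : c i = 0 := le_antisymm (by rw [← h3 i]; exact le_add_of_nonneg_right (hd i)) (hc i)
  rw [h4, zero_smul]

theorem map_mem_cone (f : U k c₁ c₂ n →ₗ[k] U k c₁ c₂ n)
    (hf : ∀ i : b.support, f (F.vec i) ∈ F.cone) {v : U k c₁ c₂ n} (hv : v ∈ F.cone) :
    f v ∈ F.cone := by
  obtain ⟨c, hc, rfl⟩ := hv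
  rw [map_sum]
  refine sum_mem fun i _ => ?_
  rw [map_smul]
  exact F.smul_mem_cone (hc i) (hf i)

theorem root_mem_cone (i : ι) : F.vec i ∈ F.cone ∨ -F.vec i ∈ F.cone := by
  have key : ∀ x ∈ AddSubmonoid.closure (P.root '' b.support), F.incl (1 ⊗ₜ x) ∈ F.cone := by
    intro x hx
    induction hx using AddSubmonoid.closure_induction with
    | mem x hx => obtain ⟨j, hj, rfl⟩ := hx; exact F.simple_mem_cone ⟨j, hj⟩
    | zero => simp
    | add x y _ _ hx hy => rw [TensorProduct.tmul_add, map_add]; exact add_mem hx hy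
  refine (b.root_mem_or_neg_mem i).imp (key _) fun h => ?_
  simpa [TensorProduct.tmul_neg, vec] using key _ h

theorem neg_vec_mem_cone_iff (i : ι) : -F.vec i ∈ F.cone ↔ F.vec i ∉ F.cone :=
  ⟨fun h h' => F.vec_ne_zero i (F.eq_zero_of_mem_cone h' h), (F.root_mem_cone i).resolve_left⟩

theorem mem_cone_iff_isPos (i : ι) : F.vec i ∈ F.cone ↔ b.IsPos i := by
  have key : ∀ f : ι → ℕ, F.incl (1 ⊗ₜ ∑ j ∈ b.support, f j • P.root j) ∈ F.cone := by
    intro f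
    rw [TensorProduct.tmul_sum, map_sum]
    refine sum_mem fun j hj => ?_
    rw [TensorProduct.tmul_smul, map_nsmul]
    exact nsmul_mem (F.simple_mem_cone ⟨j, hj⟩) _
  obtain ⟨f, -, h | h⟩ := b.exists_root_eq_sum_nat_or_neg i
  · refine iff_of_true (by rw [vec, h]; exact key f) ?_
    rw [b.isPos_iff', RootPairing.Base.height_eq_sum (f := fun j => (f j : ℤ)) (by simpa using h)]
    exact Finset.sum_nonneg fun _ _ => by positivity
  · refine iff_of_false ((F.neg_vec_mem_cone_iff i).1 ?_) ?_
    · rw [vec, h, TensorProduct.tmul_neg, map_neg, neg_neg]; exact key f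
    · rw [RootPairing.Base.IsPos, RootPairing.Base.height_eq_sum (f := fun j => -(f j : ℤ)) (by
        simpa using h), Finset.sum_neg_distrib, not_lt, neg_nonpos]
      exact Finset.sum_nonneg fun _ _ => by positivity

theorem conj_mem_cone (w : F.W) (i : ι) :
    w.1 (-F.vec i) ∈ F.cone ↔ w.1 (F.vec i) ∉ F.cone := by
  obtain ⟨j, hj⟩ := F.exists_vec w i
  rw [map_neg, hj, neg_vec_mem_cone_iff]

theorem refl_vec_self (i : ι) : F.refl i (F.vec i) = -F.vec i := by
  rw [refl_apply, coform_vec]; module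

/-! ### The half-space axioms for the Weyl group -/

section Finite

variable [Finite ι] [P.IsReduced]

/-- In a reduced system a simple reflection permutes the positive roots other than its own. -/
theorem eq_of_refl_notMem_cone {i : b.support} {j : ι} (hj : F.vec j ∈ F.cone)
    (h : F.refl i (F.vec j) ∉ F.cone) : j = i := by
  by_contra hne
  rw [mem_cone_iff_isPos] at hj
  rw [refl_vec, mem_cone_iff_isPos] at h
  exact h (hj.reflectionPerm i.2 hne)

theorem exists_word_rootRefl (i : ι) : ∃ l, wordProd F.simpleRefl l = F.rootRefl i := by
  have conj : ∀ i j, F.rootRefl j * F.rootRefl i * F.rootRefl j =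
      F.rootRefl (P.reflectionPerm j i) := by
    intro i j
    have := F.conj_rootRefl (F.rootRefl j) (F.refl_vec j i)
    rwa [inv_eq_of_mul_eq_one_left (F.rootRefl_mul_self j)] at this
  induction i using b.induction_reflect with
  | h₀ i h =>
    -- The negative of a root is its image under its own reflection, so both roots have the same
    -- reflection.
    rw [← conj, rootRefl_mul_self, one_mul]
    exact h
  | h₁ i hi => exact ⟨[⟨i, hi⟩], by simp; rfl⟩
  | h₂ i j h hj =>
    obtain ⟨l, hl⟩ := h
    refine ⟨⟨j, hj⟩ :: (l ++ [⟨j, hj⟩]), ?_⟩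
    rw [← conj, ← hl, mul_assoc]
    simp; rfl

theorem exists_word (w : F.W) : ∃ l, wordProd F.simpleRefl l = w := by
  obtain ⟨w, hw⟩ := w
  have key : ∀ i, ∀ y : F.W, (∃ l, wordProd F.simpleRefl l = y) →
      ∃ l, wordProd F.simpleRefl l = F.rootRefl i * y := by
    rintro i _ ⟨l, rfl⟩
    obtain ⟨l', hl'⟩ := F.exists_word_rootRefl i
    exact ⟨l' ++ l, by rw [wordProd_append, hl']⟩
  induction hw using Subgroup.closure_induction_left with
  | one => exact ⟨[], rfl⟩
  | mul_left x hx y hy h =>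
    obtain ⟨j, rfl⟩ := hx
    exact key j ⟨y, hy⟩ h
  | inv_mul_cancel x hx y hy h =>
    obtain ⟨j, rfl⟩ := hx
    obtain ⟨l, hl⟩ := key j ⟨y, hy⟩ h
    refine ⟨l, hl.trans (Subtype.ext ?_)⟩
    change F.refl j * y = (F.refl j)⁻¹ * y
    have : F.refl j * F.refl j = 1 := congrArg Subtype.val (F.rootRefl_mul_self j)
    rw [inv_eq_of_mul_eq_one_left this]

theorem halfSpaces :
    HalfSpaces F.simpleRefl fun w i => w.1 (F.vec i) ∈ F.cone where
  mul_self i := F.rootRefl_mul_self i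
  exists_word := F.exists_word
  pos_mul w i := by
    change w.1 (F.refl i (F.vec i)) ∈ F.cone ↔ _
    rw [refl_vec_self, conj_mem_cone]
  conj_eq w i j h h' := by
    obtain ⟨m, hm⟩ := F.exists_vec w i
    change F.refl j (w.1 (F.vec i)) ∉ F.cone at h'
    rw [hm] at h h'
    obtain rfl := F.eq_of_refl_notMem_cone h h'
    exact F.conj_rootRefl w hm

theorem genLength_lt_mul_iff (w : F.W) (i : b.support) :
    genLength F.simpleRefl w < genLength F.simpleRefl (w * F.simpleRefl i) ↔
      w.1 (F.vec i) ∈ F.cone :=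
  F.halfSpaces.genLength_lt_mul_iff F.simple_mem_cone w i

end Finite

end

end FoldedRep

end Folding

/-! ### Descents and words with doubled letters -/

namespace HalfSpaces

variable {G : Type*} [Group G] {I : Type*} {s : I → G} {pos : G → I → Prop}

theorem genLength_mul_lt_iff (H : HalfSpaces s pos) (h1 : ∀ i, pos 1 i) (g : G) (i : I) :
    genLength s (g * s i) < genLength s g ↔ ¬ pos g i := by
  rw [← H.genLength_lt_mul_iff h1, not_lt]
  exact ⟨le_of_lt, fun h => h.lt_of_ne (H.genLength_mul_ne (simple_mem i) g)⟩

/-- A reduced word in which some letters of `rs` may be repeated at once is a subword of `rs`. -/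
theorem sublist_of_sublist_flatMap (H : HalfSpaces s pos) (f : I → List I)
    (hf : ∀ r, (f r).Sublist [r, r]) (rs m : List I) (hm : m.Sublist (rs.flatMap f))
    (hr : m.length = genLength s (wordProd s m)) : m.Sublist rs := by
  induction rs generalizing m with
  | nil => simpa using hm
  | cons r rs ih =>
    rw [List.flatMap_cons] at hm
    obtain ⟨a, c, rfl, ha, hc⟩ := List.sublist_append_iff.1 hm
    have h2 := ih c hc (H.mem_redWords_of_append hr).2
    have h3 := ha.trans (hf r)
    have h4 : a = [] ∨ a = [r] ∨ a = [r, r] := by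
      rcases List.sublist_cons_iff.1 h3 with h | ⟨a', rfl, h⟩
      · rcases List.sublist_singleton.1 h with rfl | rfl <;> simp
      · rcases List.sublist_singleton.1 h with rfl | rfl <;> simp
    rcases h4 with rfl | rfl | rfl
    · exact h2.trans (List.sublist_cons_self r rs)
    · exact h2.cons_cons r
    -- Both copies of `r` would multiply to `1`, so this prefix is not reduced.
    · have h5 := (H.mem_redWords_of_append hr).1
      simp [H.mul_self] at h5

end HalfSpaces

namespace Folding

namespace FoldedRep

noncomputable section

variable {ι X Y : Type*} [AddCommGroup X] [AddCommGroup Y] {P : RootDatum ι X Y}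
variable {b : P.Base} {k : Subring ℝ} {c₁ c₂ : k} {n : ℕ} (F : FoldedRep b k c₁ c₂ n)

/-! ### The `τ`-operator and the positive cone -/

theorem vec_tauRat (i : F.rat) : F.vec (F.tauRat i) = tauOp (F.vec i.1) := F.incl_tauRat i

theorem simple_cases (i : b.support) :
    tauOp (F.vec i) = F.vec i ∨ i ∈ F.rat ∨ ∃ j, F.tauRat j = i := by
  have := F.partition.symm ▸ Set.mem_univ i
  rcases this with (h | h) | h
  exacts [Or.inl h, Or.inr (Or.inl h), Or.inr (Or.inr h)]

theorem tauOp_ne_of_rat (i : F.rat) : tauOp (F.vec i.1) ≠ F.vec i.1 :=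
  fun h => Set.disjoint_left.1 F.disjoint_inv_rat h i.2

include F in
theorem tauOp_tauOp_eq (i : ι) (u : U k c₁ c₂ n) : tauOp (tauOp u) = c₁ • tauOp u + u := by
  have h : c₂ • u = -u := (congrArg (· • u) (F.c₂_eq i)).trans (neg_one_smul k u)
  rw [tauOp_tauOp, h, sub_neg_eq_add]

include F in
theorem tauOp_injective (i : ι) : Function.Injective (tauOp : U k c₁ c₂ n →ₗ[k] U k c₁ c₂ n) := by
  rw [injective_iff_map_eq_zero]
  intro u hu
  have := F.tauOp_tauOp_eq i u
  rw [hu, map_zero, smul_zero, zero_add] at this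
  exact this.symm

/-- On $T\alpha$ with $\alpha\in\Delta_{rat}$ the operator gives $T^2\alpha=c_1T\alpha+\alpha$,
whose coefficients are nonnegative. -/
theorem tauOp_mem_cone (hc : 0 ≤ c₁) {v : U k c₁ c₂ n} (hv : v ∈ F.cone) :
    tauOp v ∈ F.cone := by
  refine F.map_mem_cone tauOp (fun i => ?_) hv
  rcases F.simple_cases i with h | h | ⟨j, rfl⟩
  · rw [h]; exact F.simple_mem_cone i
  · rw [← F.vec_tauRat ⟨i, h⟩]; exact F.simple_mem_cone _
  · have h1 := F.simple_mem_cone (F.tauRat j)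
    rw [vec_tauRat] at h1 ⊢
    rw [F.tauOp_tauOp_eq j.1]
    exact add_mem (F.smul_mem_cone hc h1) (F.simple_mem_cone j.1)

/-- The mirror case: the inverse $T-c_1$ of $T$ preserves the cone. The index `i` supplies the root
needed to know $c_2=-1$. -/
theorem mem_cone_of_tauOp (hc : c₁ ≤ 0) {v : U k c₁ c₂ n} (hv : tauOp v ∈ F.cone) (i : ι) :
    v ∈ F.cone := by
  have hc' : 0 ≤ -c₁ := neg_nonneg.2 hc
  have key := F.map_mem_cone (tauOp - c₁ • LinearMap.id) (fun i => ?_) hv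
  · have e : (tauOp - c₁ • LinearMap.id : U k c₁ c₂ n →ₗ[k] U k c₁ c₂ n) (tauOp v) = v := by
      simp only [LinearMap.sub_apply, LinearMap.smul_apply, LinearMap.id_apply]
      rw [F.tauOp_tauOp_eq i, add_sub_cancel_left]
    rwa [e] at key
  · simp only [LinearMap.sub_apply, LinearMap.smul_apply, LinearMap.id_apply]
    have h0 := F.smul_mem_cone hc' (F.simple_mem_cone i)
    rw [neg_smul] at h0
    rcases F.simple_cases i with h | h | ⟨j, rfl⟩
    · rw [h, sub_eq_add_neg]; exact add_mem (F.simple_mem_cone i) h0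
    · rw [← F.vec_tauRat ⟨i, h⟩, sub_eq_add_neg]; exact add_mem (F.simple_mem_cone _) h0
    · rw [vec_tauRat, F.tauOp_tauOp_eq j.1, add_sub_cancel_left]; exact F.simple_mem_cone j.1

/-- Roots in the same orbit of the `τ`-operator have the same sign. -/
theorem mem_cone_iff_of_tauOp {i j : ι} (h : F.vec j = tauOp (F.vec i)) :
    F.vec j ∈ F.cone ↔ F.vec i ∈ F.cone := by
  -- One implication is invariance of the cone under $T$ or its inverse; the other is the same
  -- invariance applied to the negative root.
  rcases le_total 0 c₁ with hc | hc
  · refine ⟨fun hj => ?_, fun hi => h ▸ F.tauOp_mem_cone hc hi⟩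
    by_contra hi
    rw [← neg_vec_mem_cone_iff] at hi
    have := F.tauOp_mem_cone hc hi
    rw [map_neg, ← h, neg_vec_mem_cone_iff] at this
    exact this hj
  · refine ⟨fun hj => F.mem_cone_of_tauOp hc (h ▸ hj) i, fun hi => ?_⟩
    by_contra hj
    rw [← neg_vec_mem_cone_iff, h, ← map_neg] at hj
    exact (F.neg_vec_mem_cone_iff i).1 (F.mem_cone_of_tauOp hc hj i) hi

/-! ### The folded simple reflections -/

/-- $\alpha\cdot T\alpha$ is the coefficient of $1$ in $\tau\sum_i\alpha_i^2$, and rationality makes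
this a $k$-multiple of $\tau$. -/
theorem dotU_vec_tauRat (i : F.rat) : dotU (F.vec i.1) (F.vec (F.tauRat i)) = 0 := by
  obtain ⟨-, q, hq⟩ := F.tauRational _ i.2
  have e : dotL (F.vec i.1) (tauOp (F.vec i.1)) = tau k c₁ c₂ * dotL (F.vec i.1) (F.vec i.1) := by
    rw [dotL, dotL, Finset.mul_sum]
    exact Finset.sum_congr rfl fun j _ => by
      change _ * (tau k c₁ c₂ * _) = _
      ring
  rw [vec_tauRat, ← F.tauForm_eq, tauForm, e]
  change (tau k c₁ c₂ * dotL (F.incl _) (F.incl _)).re = 0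
  rw [← hq]
  simp

theorem refl_eq_self {i : ι} {u : U k c₁ c₂ n} (h : dotU (F.vec i) u = 0) : F.refl i u = u := by
  have : F.coform i u = 0 := Subtype.ext <| by
    change 2 * (dotU (F.vec i) u : ℝ) / _ = _
    rw [h]; simp
  rw [refl_apply, this, zero_smul, sub_zero]

theorem refl_vec_tauRat (i : F.rat) : F.refl i.1 (F.vec (F.tauRat i)) = F.vec (F.tauRat i) :=
  F.refl_eq_self (F.dotU_vec_tauRat i)

theorem refl_tauRat_vec (i : F.rat) : F.refl (F.tauRat i) (F.vec i.1) = F.vec i.1 :=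
  F.refl_eq_self (by rw [dotU_comm, F.dotU_vec_tauRat i])

theorem commute_tauRat (i : F.rat) :
    F.rootRefl i.1 * F.rootRefl (F.tauRat i) = F.rootRefl (F.tauRat i) * F.rootRefl i.1 :=
  mul_inv_eq_iff_eq_mul.1 (F.conj_rootRefl (F.rootRefl i.1) (F.refl_vec_tauRat i))

theorem pairRefl_of_rat {i : F.FoldIdx} (h : i.1 ∈ F.rat) :
    F.pairRefl i = F.rootRefl i.1 * F.rootRefl (F.tauRat ⟨i.1, h⟩) := by
  rw [pairRefl, dif_pos h]; rfl

theorem pairRefl_of_notMem_rat {i : F.FoldIdx} (h : i.1 ∉ F.rat) :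
    F.pairRefl i = F.rootRefl i.1 := by
  rw [pairRefl, dif_neg h]; rfl

theorem pairRefl_mul_self (i : F.FoldIdx) : F.pairRefl i * F.pairRefl i = 1 := by
  by_cases h : i.1 ∈ F.rat
  · rw [F.pairRefl_of_rat h]
    nth_rw 2 [F.commute_tauRat ⟨i.1, h⟩]
    rw [mul_assoc, ← mul_assoc (F.rootRefl (F.tauRat ⟨i.1, h⟩)), rootRefl_mul_self, one_mul,
      rootRefl_mul_self]
  · rw [F.pairRefl_of_notMem_rat h, rootRefl_mul_self]

theorem simpleReflTau_mul_self (i : F.FoldIdx) : F.simpleReflTau i * F.simpleReflTau i = 1 :=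
  F.embed_injective (by rw [map_mul, embed_simpleReflTau, pairRefl_mul_self, map_one])

theorem exists_word_tau (u : F.Wtau) : ∃ l, wordProd F.simpleReflTau l = u := by
  obtain ⟨u, hu⟩ := u
  induction hu using Subgroup.closure_induction_left with
  | one => exact ⟨[], rfl⟩
  | mul_left x hx y hy h =>
    obtain ⟨i, rfl⟩ := hx
    obtain ⟨l, hl⟩ := h
    exact ⟨i :: l, by rw [wordProd_cons, hl]; rfl⟩
  | inv_mul_cancel x hx y hy h =>
    obtain ⟨i, rfl⟩ := hx
    obtain ⟨l, hl⟩ := h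
    have e : F.simpleReflTau i = (F.simpleReflTau i)⁻¹ :=
      eq_inv_of_mul_eq_one_left (F.simpleReflTau_mul_self i)
    have e' : F.foldRefl i = (F.foldRefl i)⁻¹ := congrArg Subtype.val e
    refine ⟨i :: l, ?_⟩
    rw [wordProd_cons, hl]
    exact Subtype.ext (congrArg (· * y) e')

/-- The map `ε : W_τ → W` as a plain function. -/
def toW (u : F.Wtau) : F.W := F.embed u

theorem toW_one : F.toW 1 = 1 := MonoidHom.map_one F.embed

theorem toW_mul (u : F.Wtau) (i : F.FoldIdx) :
    F.toW (u * F.simpleReflTau i) = F.toW u * F.pairRefl i :=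
  (MonoidHom.map_mul F.embed _ _).trans (congrArg (F.toW u * ·) (F.embed_simpleReflTau i))

theorem toW_simple_mul (u : F.Wtau) (i : F.FoldIdx) :
    F.toW (F.simpleReflTau i * u) = F.pairRefl i * F.toW u :=
  (MonoidHom.map_mul F.embed _ _).trans (congrArg (· * F.toW u) (F.embed_simpleReflTau i))

theorem toW_injective : Function.Injective F.toW := F.embed_injective

/-- The elements of `W` that commute with the `τ`-operator. -/
def CommutesTau (w : F.W) : Prop := ∀ v, w.1 (tauOp v) = tauOp (w.1 v)

theorem commutesTau_wordProd (l : List F.FoldIdx) : F.CommutesTau (wordProd F.pairRefl l) := by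
  induction l with
  | nil => exact fun v => rfl
  | cons i l ih =>
    rw [wordProd_cons]
    intro v
    change (F.pairRefl i).1 ((wordProd F.pairRefl l).1 _) =
      tauOp ((F.pairRefl i).1 ((wordProd F.pairRefl l).1 _))
    rw [ih, pairRefl_comm]

theorem toW_wordProd (l : List F.FoldIdx) :
    F.toW (wordProd F.simpleReflTau l) = wordProd F.pairRefl l := by
  induction l with
  | nil => exact F.toW_one
  | cons i l ih => rw [wordProd_cons, wordProd_cons, ← ih, toW_simple_mul]

theorem commutesTau_toW (u : F.Wtau) : F.CommutesTau (F.toW u) := by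
  have := F.exists_word_tau u
  rcases this with ⟨l, hl⟩
  have h := F.commutesTau_wordProd l
  rwa [← F.toW_wordProd l, hl] at h

/-- Since $wT\alpha=T(w\alpha)$, one sign serves for both members of a pair; this is why `PosTau`
tests only the representative. -/
theorem vec_tauRat_mem_cone_iff {w : F.W} (hw : F.CommutesTau w) (i : F.rat) :
    w.1 (F.vec (F.tauRat i)) ∈ F.cone ↔ w.1 (F.vec i.1) ∈ F.cone := by
  obtain ⟨j, hj⟩ := F.exists_vec w i.1
  obtain ⟨j', hj'⟩ := F.exists_vec w (F.tauRat i)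
  rw [hj, hj']
  refine F.mem_cone_iff_of_tauOp ?_
  rw [← hj, ← hj', vec_tauRat, hw]

theorem pairRefl_vec_self (i : F.FoldIdx) : (F.pairRefl i).1 (F.vec i.1) = -F.vec i.1 := by
  by_cases h : i.1 ∈ F.rat
  · rw [F.pairRefl_of_rat h]
    exact (congrArg (F.refl i.1) (F.refl_tauRat_vec ⟨i.1, h⟩)).trans (F.refl_vec_self i.1)
  · rw [F.pairRefl_of_notMem_rat h]
    exact F.refl_vec_self i.1

/-! ### The half-space axioms for the folded group -/

section Finite

variable [Finite ι] [P.IsReduced]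

/-- If $s_{T\alpha}$ keeps $\beta$ positive, then $s_\alpha$ makes $s_{T\alpha}\beta$ negative, so
$s_{T\alpha}\beta=\alpha$ and $\beta=\alpha$ by orthogonality. -/
theorem eq_of_pairRefl_notMem_cone {i : F.FoldIdx} {j : ι} (hj : F.vec j ∈ F.cone)
    (h : (F.pairRefl i).1 (F.vec j) ∉ F.cone) :
    j = i.1 ∨ ∃ h : i.1 ∈ F.rat, j = F.tauRat ⟨i.1, h⟩ := by
  by_cases hi : i.1 ∈ F.rat
  · rw [F.pairRefl_of_rat hi] at h
    change F.refl i.1 (F.refl (F.tauRat ⟨i.1, hi⟩) (F.vec j)) ∉ F.cone at h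
    by_cases h' : F.refl (F.tauRat ⟨i.1, hi⟩) (F.vec j) ∈ F.cone
    · left
      have e := F.refl_vec (F.tauRat ⟨i.1, hi⟩) j
      rw [e] at h h'
      rw [F.eq_of_refl_notMem_cone h' h, ← F.refl_tauRat_vec ⟨i.1, hi⟩] at e
      exact F.vec_injective ((F.refl (F.tauRat ⟨i.1, hi⟩)).injective e)
    · exact Or.inr ⟨hi, F.eq_of_refl_notMem_cone hj h'⟩
  · rw [F.pairRefl_of_notMem_rat hi] at h
    exact Or.inl (F.eq_of_refl_notMem_cone hj h)

/-- The root $w\alpha_i$ is made negative by the $j$-th generator, so it is $\alpha_j$ or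
$T\alpha_j$. As `w` commutes with $T$, it carries a pair onto a pair and a $T$-fixed root to a
$T$-fixed root. -/
theorem conj_pairRefl_eq {w : F.W} (hw : F.CommutesTau w) (i j : F.FoldIdx)
    (h : w.1 (F.vec i.1) ∈ F.cone)
    (h' : (F.pairRefl j).1 (w.1 (F.vec i.1)) ∉ F.cone) :
    w * F.pairRefl i * w⁻¹ = F.pairRefl j := by
  obtain ⟨m, hm⟩ := F.exists_vec w i.1
  have hm1 := F.eq_of_pairRefl_notMem_cone (hm ▸ h) (hm ▸ h')
  by_cases hi : i.1 ∈ F.rat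
  · obtain ⟨m', hm'⟩ := F.exists_vec w (F.tauRat ⟨i.1, hi⟩)
    have hT : F.vec m' = tauOp (F.vec m) := by rw [← hm, ← hm', vec_tauRat, hw]
    have hne : m' ≠ m := by
      rintro rfl
      rw [← hm, ← hw] at hT
      exact F.tauOp_ne_of_rat ⟨i.1, hi⟩ (w.1.injective hT).symm
    have hc' : F.vec m' ∈ F.cone := (F.mem_cone_iff_of_tauOp hT).2 (hm ▸ h)
    have hm2 := F.eq_of_pairRefl_notMem_cone (i := j) hc' (by
      obtain ⟨a, ha⟩ := F.exists_vec (F.pairRefl j) m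
      obtain ⟨a', ha'⟩ := F.exists_vec (F.pairRefl j) m'
      rw [hm, ha] at h'
      rw [ha', F.mem_cone_iff_of_tauOp (i := a)]
      · exact h'
      · rw [← ha, ← ha', hT, pairRefl_comm])
    have e : w * F.pairRefl i * w⁻¹ = F.rootRefl m * F.rootRefl m' := by
      rw [F.pairRefl_of_rat hi, ← F.conj_rootRefl _ hm, ← F.conj_rootRefl _ hm']
      group
    rw [e]
    rcases hm1 with rfl | ⟨hj, rfl⟩
    · rcases hm2 with rfl | ⟨hj, rfl⟩
      · exact absurd rfl hne
      · rw [F.pairRefl_of_rat hj]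
    · rcases hm2 with rfl | ⟨hj, rfl⟩
      · rw [F.pairRefl_of_rat hj, F.commute_tauRat ⟨j.1, hj⟩]
      · exact absurd rfl hne
  · have hT : tauOp (F.vec m) = F.vec m := by
      rw [← hm, ← hw, i.2.resolve_right hi]
    rw [F.pairRefl_of_notMem_rat hi, F.conj_rootRefl _ hm]
    -- Neither $\alpha_j$ nor $T\alpha_j$ is fixed by $T$ when $\alpha_j\in\Delta_{rat}$.
    have hj : j.1 ∉ F.rat := by
      intro hj
      rcases hm1 with rfl | ⟨hj, rfl⟩
      · exact F.tauOp_ne_of_rat ⟨j.1, hj⟩ hT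
      · rw [vec_tauRat] at hT
        exact F.tauOp_ne_of_rat ⟨j.1, hj⟩ (F.tauOp_injective j.1.1 hT)
    rcases hm1 with rfl | ⟨hj', -⟩
    · rw [F.pairRefl_of_notMem_rat hj]
    · exact absurd hj' hj

/-- `PosTau u i` says that `ε(u)` sends the `i`-th simple root to a positive root. -/
def PosTau (u : F.Wtau) (i : F.FoldIdx) : Prop := (F.toW u).1 (F.vec i.1) ∈ F.cone

theorem halfSpaces_tau : HalfSpaces F.simpleReflTau F.PosTau where
  mul_self := F.simpleReflTau_mul_self
  exists_word := F.exists_word_tau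
  pos_mul u i := by
    rw [PosTau, PosTau, toW_mul]
    change (F.toW u).1 ((F.pairRefl i).1 (F.vec i.1)) ∈ F.cone ↔ _
    rw [pairRefl_vec_self, conj_mem_cone]
  conj_eq u i j h h' := by
    rw [PosTau, toW_simple_mul] at h'
    apply F.toW_injective
    have h1 := F.conj_pairRefl_eq (F.commutesTau_toW u) i j h h'
    rw [mul_inv_eq_iff_eq_mul, ← toW_mul, ← toW_simple_mul] at h1
    rw [F.toW_injective h1, mul_inv_cancel_right]

omit [Finite ι] [P.IsReduced] in
theorem posTau_one (i : F.FoldIdx) : F.PosTau 1 i := by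
  rw [PosTau, toW_one]; exact F.simple_mem_cone i.1

theorem genLength_lt_mul_iff_tau (u : F.Wtau) (i : F.FoldIdx) :
    genLength F.simpleReflTau u < genLength F.simpleReflTau (u * F.simpleReflTau i) ↔
      F.PosTau u i :=
  F.halfSpaces_tau.genLength_lt_mul_iff F.posTau_one u i

/-! ### Comparison of the two Bruhat orders -/

omit [Finite ι] [P.IsReduced] in
theorem phi_eq_iff {t : b.support} {r : F.FoldIdx} (h : F.phi t = r) :
    t = r.1 ∨ ∃ h : r.1 ∈ F.rat, t = F.tauRat ⟨r.1, h⟩ := by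
  subst h
  by_cases ht : ∃ j, F.tauRat j = t
  · obtain ⟨j, rfl⟩ := ht
    right
    rw [phi_tauRat]
    exact ⟨j.2, rfl⟩
  · left
    exact (congrArg Subtype.val (F.phi_foldIdx ⟨t, F.mem_foldIdx_of_notMem_range ht⟩)).symm

omit [Finite ι] [P.IsReduced] in
theorem vec_mem_cone_iff_phi {w : F.W} (hw : F.CommutesTau w) (t : b.support) :
    w.1 (F.vec t) ∈ F.cone ↔ w.1 (F.vec (F.phi t).1) ∈ F.cone := by
  rcases F.phi_eq_iff (t := t) rfl with h | ⟨h, h'⟩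
  · rw [← h]
  · rw [← F.vec_tauRat_mem_cone_iff hw ⟨_, h⟩, ← h']

/-- `s_t` is one of the at most two factors of the generator `r`, and all of them are ascents. Lift
along the factor `t`; the other one only enlarges the right-hand side. -/
theorem bruhatLE_mul_pairRefl {v w : F.W} (hw : F.CommutesTau w) (h : bruhatLE F.simpleRefl v w)
    {t : b.support} {r : F.FoldIdx} (hr : F.phi t = r) (hpos : w.1 (F.vec r.1) ∈ F.cone) :
    bruhatLE F.simpleRefl (v * F.simpleRefl t) (w * F.pairRefl r) := by
  have h1 := (F.genLength_lt_mul_iff w r.1).2 hpos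
  by_cases hrat : r.1 ∈ F.rat
  · have h2 := (F.genLength_lt_mul_iff (w * F.simpleRefl r.1) (F.tauRat ⟨_, hrat⟩)).2 <| by
      change w.1 (F.refl r.1 (F.vec (F.tauRat ⟨_, hrat⟩))) ∈ F.cone
      rwa [F.refl_vec_tauRat ⟨_, hrat⟩, F.vec_tauRat_mem_cone_iff hw]
    have e : w * F.pairRefl r = w * F.simpleRefl r.1 * F.simpleRefl (F.tauRat ⟨_, hrat⟩) := by
      rw [F.pairRefl_of_rat hrat, mul_assoc]; rfl
    rw [e]
    rcases F.phi_eq_iff hr with rfl | ⟨_, rfl⟩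
    · exact (F.halfSpaces.bruhatLE_mul_mul h h1).trans (HalfSpaces.bruhatLE_mul_self h2)
    · exact F.halfSpaces.bruhatLE_mul_mul (h.trans (HalfSpaces.bruhatLE_mul_self h1)) h2
  · rw [F.pairRefl_of_notMem_rat hrat]
    rcases F.phi_eq_iff hr with rfl | ⟨h', -⟩
    · exact F.halfSpaces.bruhatLE_mul_mul h h1
    · exact absurd h' hrat

theorem bruhatLE_toW_mul {w : F.W} {u : F.Wtau} (h : bruhatLE F.simpleRefl w (F.toW u))
    (t : b.support)
    (hu : genLength F.simpleReflTau u < genLength F.simpleReflTau (u * F.simpleReflTau (F.phi t))) :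
    bruhatLE F.simpleRefl (w * F.simpleRefl t) (F.toW (u * F.simpleReflTau (F.phi t))) := by
  rw [toW_mul]
  exact F.bruhatLE_mul_pairRefl (F.commutesTau_toW u) h rfl
    ((F.genLength_lt_mul_iff_tau u _).1 hu)

/-- If $\varphi(s_t)$ is a descent of $u$, then $s_t$ is a descent of $\varepsilon(u)$, as `t` and
its representative have the same sign. -/
theorem bruhatLE_toW_of_not {w : F.W} {u : F.Wtau} (h : bruhatLE F.simpleRefl w (F.toW u))
    (t : b.support)
    (hu : ¬ genLength F.simpleReflTau u <
      genLength F.simpleReflTau (u * F.simpleReflTau (F.phi t))) :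
    bruhatLE F.simpleRefl (w * F.simpleRefl t) (F.toW u) := by
  rw [genLength_lt_mul_iff_tau, PosTau,
    ← F.vec_mem_cone_iff_phi (F.commutesTau_toW u)] at hu
  exact F.halfSpaces.bruhatLE_mul_left h
    ((F.halfSpaces.genLength_mul_lt_iff F.simple_mem_cone _ _).2 hu)

/-- Every word is dominated by the image of an element of `W_τ` that is at most as long; if the
folded word is not reduced then this element is shorter. -/
theorem exists_bruhatLE_toW (l : List b.support) : ∃ u : F.Wtau,
    bruhatLE F.simpleRefl (wordProd F.simpleRefl l) (F.toW u) ∧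
      genLength F.simpleReflTau u ≤ l.length ∧
      (l.length ≤ genLength F.simpleReflTau u → wordProd F.simpleReflTau (l.map F.phi) = u) := by
  induction l using List.reverseRecOn with
  | nil =>
    refine ⟨1, ?_, (genLength_one _).le, fun _ => rfl⟩
    rw [toW_one]
    exact .refl
  | append_singleton l t ih =>
    obtain ⟨u, h1, h2, h3⟩ := ih
    simp only [wordProd_append, List.map_append, List.map_cons, List.map_nil, wordProd_cons,
      wordProd_nil, mul_one, List.length_append, List.length_singleton]
    -- The witness is the Demazure product of the folded word. A skipped letter leaves it strictly
    -- shorter than the word, so the last clause becomes vacuous.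
    by_cases hu : genLength F.simpleReflTau u <
      genLength F.simpleReflTau (u * F.simpleReflTau (F.phi t))
    · have h4 := F.halfSpaces_tau.genLength_mul_le u (F.phi t)
      refine ⟨_, F.bruhatLE_toW_mul h1 t hu, by omega, fun h5 => ?_⟩
      rw [h3 (by omega)]
    · exact ⟨u, F.bruhatLE_toW_of_not h1 t hu, by omega, fun h5 => by omega⟩

theorem bruhatLE_toW_of_reduced (l : List b.support)
    (hl : (l.map F.phi).length =
      genLength F.simpleReflTau (wordProd F.simpleReflTau (l.map F.phi))) :
    bruhatLE F.simpleRefl (wordProd F.simpleRefl l)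
      (F.toW (wordProd F.simpleReflTau (l.map F.phi))) := by
  induction l using List.reverseRecOn with
  | nil =>
    rw [List.map_nil, wordProd_nil, wordProd_nil, toW_one]
    exact .refl
  | append_singleton l t ih =>
    rw [List.map_append] at hl ⊢
    have h1 := (F.halfSpaces_tau.mem_redWords_of_append hl).1
    have h2 := F.bruhatLE_toW_mul (ih h1) t <| by
      rw [← h1]
      simp only [wordProd_append, List.map_cons, List.map_nil, wordProd_cons,
        wordProd_nil, mul_one, List.length_append, List.length_singleton] at hl
      omega
    simpa only [wordProd_append, List.map_cons, List.map_nil, wordProd_cons, wordProd_nil,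
      mul_one] using h2

open Classical in
/-- The word of simple reflections representing `pairRefl`. -/
def pairWord (r : F.FoldIdx) : List b.support :=
  if h : r.1 ∈ F.rat then [r.1, F.tauRat ⟨r.1, h⟩] else [r.1]

omit [Finite ι] [P.IsReduced] in
theorem wordProd_pairWord (r : F.FoldIdx) : wordProd F.simpleRefl (F.pairWord r) = F.pairRefl r := by
  by_cases h : r.1 ∈ F.rat <;> simp [pairWord, pairRefl, h]

omit [Finite ι] [P.IsReduced] in
theorem map_phi_pairWord (r : F.FoldIdx) : ((F.pairWord r).map F.phi).Sublist [r, r] := by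
  by_cases h : r.1 ∈ F.rat <;> simp [pairWord, h, phi_foldIdx, phi_tauRat]

omit [Finite ι] [P.IsReduced] in
theorem wordProd_flatMap_pairWord (rs : List F.FoldIdx) :
    wordProd F.simpleRefl (rs.flatMap F.pairWord) = F.toW (wordProd F.simpleReflTau rs) := by
  rw [toW_wordProd]
  induction rs with
  | nil => rfl
  | cons r rs ih => rw [List.flatMap_cons, wordProd_append, ih, wordProd_pairWord, wordProd_cons]

/-- If the folding of each reduced word of `w` is a reduced word of `u`, then `u` is minimal with
`w ≤ ε(u)`. -/
theorem bruhatLE_of_bruhatLE_toW {w : F.W} {u u' : F.Wtau}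
    (hw : ∀ l ∈ redWords F.simpleRefl w, l.map F.phi ∈ redWords F.simpleReflTau u)
    (h : bruhatLE F.simpleRefl w (F.toW u')) : bruhatLE F.simpleReflTau u u' := by
  obtain ⟨rs, rfl, hrs⟩ := F.halfSpaces_tau.exists_mem_redWords u'
  obtain ⟨l, hl, hlw⟩ := F.halfSpaces.exists_sublist_of_bruhatLE h _
    (F.wordProd_flatMap_pairWord rs)
  obtain ⟨h1, h2⟩ := hw l hlw
  rw [← h1] at h2 ⊢
  refine F.halfSpaces_tau.bruhatLE_of_sublist ?_ hrs
  -- The folded word sits inside `rs` with the letters of $\Delta_{rat}$ doubled; being reduced, it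
  -- uses no letter twice in a row.
  refine F.halfSpaces_tau.sublist_of_sublist_flatMap _ F.map_phi_pairWord _ _ ?_ h2
  simpa only [List.map_flatMap] using hl.map F.phi

omit [Finite ι] [P.IsReduced] in
theorem map_phi_mem_redWords {w : F.W} (hw : w ∈ F.foldingSubset) {l : List b.support}
    (hl : l ∈ redWords F.simpleRefl w) :
    l.map F.phi ∈ redWords F.simpleReflTau (F.phiBar ⟨w, hw⟩) := by
  have e := F.phiBar_eq ⟨w, hw⟩ hl
  refine ⟨e.symm, ?_⟩
  rcases hw with rfl | ⟨h1, h2⟩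
  · have h0 : l = [] := List.length_eq_zero_iff.1 (hl.2.trans (genLength_one _))
    subst h0
    rw [F.phiBar_eq ⟨1, Or.inl rfl⟩ hl]
    exact (genLength_one _).symm
  · obtain ⟨v, hv⟩ := Set.mem_iUnion.1 (h1 l hl)
    have e := F.phiBar_eq ⟨w, Or.inr ⟨h1, h2⟩⟩ hl
    rw [hv.2, e, hv.1]

end Finite

end

end FoldedRep

end Folding

/-! ### The theorem -/

theorem mainTheorem3 {ι X Y : Type*} [Finite ι] [AddCommGroup X] [AddCommGroup Y]
    [Module.Free ℤ X] [Module.Finite ℤ X] (P : RootDatum ι X Y) [P.IsReduced] (b : P.Base)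
    (hlaced : b.cartanMatrix.IsSimplyLaced)
    (k : Subring ℝ) (c₁ c₂ : k) (n : ℕ) (F : Folding.FoldedRep b k c₁ c₂ n)
    (u : F.Wtau) (ℓ : ℕ) (hu : genLength F.simpleReflTau u = ℓ) (w : F.W) :
    (genLength F.simpleRefl w = ℓ ∧
      bruhatLE F.simpleRefl w (F.embed u) ∧
      ∀ u' : F.Wtau, ¬ bruhatLE F.simpleReflTau u u' → ¬ bruhatLE F.simpleRefl w (F.embed u')) ↔
    ∃ hw : w ∈ F.foldingSubset, F.phiBar ⟨w, hw⟩ = u := by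
  constructor
  · rintro ⟨hw, -, hmin⟩
    have key : ∀ l ∈ redWords F.simpleRefl w, l.map F.phi ∈ redWords F.simpleReflTau u := by
      rintro l ⟨rfl, hl⟩
      obtain ⟨u', h1, h2, h3⟩ := F.exists_bruhatLE_toW l
      have h4 : bruhatLE F.simpleReflTau u u' := by
        by_contra h
        exact hmin u' h h1
      have h5 := h4.genLength_le
      -- $u\le u'$ and $l_\tau(u')\le|l|=l_\tau(u)$ force $u=u'$. The length bound is then attained,
      -- so the folded word is reduced.
      obtain rfl := h4.eq_of_genLength_le (by omega)
      exact ⟨h3 (by omega), by rw [List.length_map]; omega⟩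
    have hmem : w ∈ F.foldingSubset :=
      Or.inr ⟨fun l hl => Set.mem_iUnion.2 ⟨u, key l hl⟩,
        fun l hl l' hl' => ⟨u, key l hl, key l' hl'⟩⟩
    obtain ⟨l, hl⟩ := F.halfSpaces.exists_mem_redWords w
    exact ⟨hmem, (F.phiBar_eq ⟨w, hmem⟩ hl).trans (key l hl).1⟩
  · rintro ⟨hw, rfl⟩
    obtain ⟨l, hl⟩ := F.halfSpaces.exists_mem_redWords w
    have h1 := F.map_phi_mem_redWords hw hl
    refine ⟨?_, ?_, fun u' h h' => h (F.bruhatLE_of_bruhatLE_toW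
      (fun l hl => F.map_phi_mem_redWords hw hl) h')⟩
    · rw [← hu, ← hl.2, ← h1.2, List.length_map]
    · have := F.bruhatLE_toW_of_reduced l (by rw [h1.1]; exact h1.2)
      rwa [h1.1, hl.1] at this
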